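/- **Setting.** Let $\mathcal E$ be a complex Hilbert space and let $H_0=\sum_i E_i\,|\Phi_i\rangle\langle\Phi_i|$ be a (possibly unbounded) self-adjoint operator given by a Hilbert basis $(\Phi_i)$ of eigenvectors with real eigenvalues $E_i$; assume that there is a lowest eigenvalue $E_0$, possibly degenerate, and let $P$ be the orthogonal projection on its eigenspace. Let $V$ be a bounded self-adjoint operator. For $\varepsilon>0$ put $H_{I\varepsilon}(t)=e^{iH_0t}Ve^{-iH_0t}e^{-\varepsilon|t|}$, and let $U_\varepsilon(t)$ be the bounded operators solving $i\,\partial_tU_\varepsilon(t)=H_{I\varepsilon}(t)U_\varepsilon(t)$, $U_\varepsilon(-\infty)=1$ (derivative and limit in the strong sense). Put $$U_{GL}(\varepsilon)=U_\varepsilon(0)P\,\bigl(PU_\varepsilon(0)P\bigr)^{-1},$$ the inverse being taken within the image of $P$. The effective adiabatic evolution operator is $U_{GL}=\lim_{\varepsilon\to0^+}U_{GL}(\varepsilon)$. Let $H_i=-iH_{I\varepsilon}$, $A=(1-P)H_i$, $B=-PH_i$, and $\Delta_n=\{-\infty<t_n\le\dots\le t_1\le 0\}$. A signed permutation $\bar\sigma\in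 B_n$ is a permutation $\sigma=(\sigma(1),\dots,\sigma(n))$ in which every entry may carry a bar. Let $\langle\bar\sigma\rangle=\int_{\Delta_n}X_1(t_{\sigma(1)})\cdots X_n(t_{\sigma(n)})\,dt$, where $X_j=B$ if the $j$-th entry of $\bar\sigma$ is barred and $X_j=A$ otherwise; integrals of operators are taken strongly, i.e. on each vector; $\langle\cdot\rangle$ is extended linearly to $\mathbb Q[B_n]$. The signed permutation $\bar\sigma$ has a progression in position $j<n$ if either $\sigma(j)<\sigma(j+1)$ and the $(j+1)$-st entry is not barred, or $\sigma(j)>\sigma(j+1)$ and the $(j+1)$-st entry is barred; otherwise it has a regression in position $j$. Let $R^n_\emptyset\in\mathbb Q[B_n]$ be the sum of all signed permutations without regression. Replacing $V$ by $\lambda V$ multiplies an $n$-fold iterated integral by $\lambda^n$; let $$\mathcal U_\varepsilon=\sum_{n\ge0}\lambda^n\int_{\Delta_n}H_i(t_1)\cdots H_i(t_n)\,dt,\qquad \mathcal R_\varepsilon=\sum_{n\ge1}\lambda^n\langle R^n_\emptyset\rangle$$ be the corresponding formal power series in $\lambda$ with bounded operators as coefficients. **Theorem** (hyperoctahedral Picard-type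 expansion of $U_{GL}$). 1. (Formal expansion.) For every $\varepsilon>0$, the coefficients of $\mathcal U_\varepsilon$ form a summable family in operator norm with sum $U_\varepsilon(0)$ (the Picard expansion), and, as formal power series in $\lambda$, $$\mathcal U_\varepsilon P=\bigl(P+(1-P)\,\mathcal R_\varepsilon\,P\bigr)\,P\,\mathcal U_\varepsilon P .$$ Moreover $P\,\mathcal U_\varepsilon P$ is invertible (as a formal series of operators on the image of $P$), and $\mathcal U_\varepsilon P\,(P\,\mathcal U_\varepsilon P)^{-1}=P+(1-P)\,\mathcal R_\varepsilon\,P$. 2. (Operator identity.) Let $\varepsilon>0$ and let $S$ be a bounded operator such that the partial sums of $\sum_{n\ge1}(1-P)\langle R^n_\emptyset\rangle P$ converge strongly to $(1-P)SP$ (for example $S=\sum_{n\ge1}\langle R^n_\emptyset\rangle$, when this series converges). Then $$U_\varepsilon(0)P=\Bigl(P+(1-P)\Bigl(\sum_{n\ge1}\langle R^n_\emptyset\rangle\Bigr)P\Bigr)\,P\,U_\varepsilon(0)P ,$$ where $(1-P)\bigl(\sum_{n\ge1}\langle R_\emptyset^n\rangle\bigr)P$ stands for $(1-P)SP$; and if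 $PU_\varepsilon(0)P$ is invertible within the image of $P$, then $$U_{GL}(\varepsilon)=P+(1-P)\Bigl(\sum_{n\ge1}\langle R^n_\emptyset\rangle\Bigr)P .$$ 3. (Limit $\varepsilon\to0^+$.) $$U_{GL}=\lim_{\varepsilon\to0^+}\Bigl[P+(1-P)\Bigl(\sum_{n\ge1}\langle R^n_\emptyset\rangle\Bigr)P\Bigr]$$ in both readings: (a) formally, for each $n$, the coefficient of $\lambda^n$ in $\mathcal U_\varepsilon P\,(P\,\mathcal U_\varepsilon P)^{-1}$ has a limit as $\varepsilon\to0^+$ if and only if that of $P+(1-P)\mathcal R_\varepsilon P$ has one, and the limits agree; (b) if, for all sufficiently small $\varepsilon>0$, $PU_\varepsilon(0)P$ is invertible within the image of $P$ and the series $\sum_{n\ge1}(1-P)\langle R^n_\emptyset\rangle P$ converges as in 2., then $U_{GL}(\varepsilon)$ has a limit as $\varepsilon\to0^+$ if and only if $P+(1-P)\bigl(\sum_{n\ge1}\langle R^n_\emptyset\rangle\bigr)P$ has one, and the limits agree. Both hold for limits in operator norm and for strong limits. -/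

import Mathlib

open MeasureTheory Filter Topology

namespace HyperPicard

noncomputable section

/-! ### Signed permutations, regressions -/

/-- A signed permutation of `{1, …, n}`, written as the sequence of its values: the `i`-th entry is
`perm i`, and it carries an upper bar iff `bar i = true`. -/
@[ext]
structure SignedPerm (n : ℕ) where
  perm : Equiv.Perm (Fin n)
  bar : Fin n → Bool

/-- A signed permutation is a permutation together with a choice of bars. -/
def SignedPerm.equivProd (n : ℕ) : SignedPerm n ≃ Equiv.Perm (Fin n) × (Fin n → Bool) where
  toFun s := (s.perm, s.bar)
  invFun p := ⟨p.1, p.2⟩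
  left_inv _ := rfl
  right_inv _ := rfl

instance (n : ℕ) : Fintype (SignedPerm n) :=
  Fintype.ofEquiv _ (SignedPerm.equivProd n).symm

instance (n : ℕ) : DecidableEq (SignedPerm n) :=
  (SignedPerm.equivProd n).decidableEq

/-- The signed permutation `s` has a progression in passing from the entry at `i` to the next entry
at `j`: the entry increases in absolute value and the new one has no bar, or it decreases in
absolute value and the new one has a bar. -/
def SignedPerm.Progression {n : ℕ} (s : SignedPerm n) (i j : Fin n) : Prop :=
  (s.perm i < s.perm j ∧ s.bar j = false) ∨ (s.perm j < s.perm i ∧ s.bar j = true)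

/-- The set of regressions, as a subset of `{1, …, n - 1}`: the position `k` (counted from `1`)
belongs to it iff the passage from the `k`-th to the `(k+1)`-st entry is not a progression. -/
def SignedPerm.reg {n : ℕ} (s : SignedPerm n) : Set ℕ :=
  {k | ∃ i j : Fin n, (i : ℕ) + 1 = k ∧ (j : ℕ) = k ∧ ¬ s.Progression i j}

open Classical in
/-- The element `R_S^n` of `ℚ[B_n]`: the sum of all signed permutations whose set of regressions
is `S`. -/
def regressionSum (n : ℕ) (S : Set ℕ) : SignedPerm n →₀ ℚ :=
  ∑ s : SignedPerm n with s.reg = S, Finsupp.single s 1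

/-! ### Inverses on the image of a projection, and the Gell-Mann–Low quotient -/

section Ring

variable {R : Type*} [Ring R]

/-- For an idempotent `p` and `t = p t p`: the element `w = p w p` is the inverse of `t` in the
ring `p R p`, whose unit is `p`. For operators: `w` inverts `t` within the image of `p`. -/
def IsInverseOn (p t w : R) : Prop :=
  p * w * p = w ∧ w * t = p ∧ t * w = p

/-- `t` is invertible within the image of `p`. -/
def InvertibleOn (p t : R) : Prop := ∃ w, IsInverseOn p t w

open Classical in
/-- The inverse of `t` within the image of `p` (and `0` if there is none). -/
def inverseOn (p t : R) : R := if h : InvertibleOn p t then h.choose else 0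

/-- The inverse within the image of `p` is unique, so that `inverseOn` is well defined. -/
theorem IsInverseOn.eq_inverseOn {p t w : R} (hp : p * p = p) (h : IsInverseOn p t w) :
    w = inverseOn p t := by
  have hex : InvertibleOn p t := ⟨w, h⟩
  have h' : IsInverseOn p t (inverseOn p t) := by
    rw [inverseOn, dif_pos hex]; exact hex.choose_spec
  generalize inverseOn p t = w' at h'
  have e1 : w * p = w := by
    conv_lhs => rw [← h.1]
    rw [mul_assoc, hp, h.1]
  have e2 : p * w' = w' := by
    conv_lhs => rw [← h'.1]
    rw [← mul_assoc, ← mul_assoc, hp, h'.1]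
  calc w = w * p := e1.symm
    _ = w * (t * w') := by rw [h'.2.2]
    _ = w' := by rw [← mul_assoc, h.2.1, e2]

/-- `u p (p u p)⁻¹`, the inverse being taken within the image of `p`. -/
def gellMannLow (p u : R) : R := u * p * inverseOn p (p * u * p)

end Ring

/-! ### The time-dependent interaction representation -/

section Operators

variable {ι E : Type*} [NormedAddCommGroup E] [InnerProductSpace ℂ E] [CompleteSpace E]

/-- The unperturbed Hamiltonian `H₀ = ∑ i, en i • |Φ i⟩⟨Φ i|` is given by its eigenvectors `Φ i`,
a Hilbert basis, and its eigenvalues `en i`. The vectors `e^{i θ H₀} Φ j = e^{i θ en j} Φ j` form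
a Hilbert basis again. -/
def rotatedBasis (Φ : HilbertBasis ι ℂ E) (en : ι → ℝ) (θ : ℝ) : HilbertBasis ι ℂ E :=
  HilbertBasis.mkOfOrthogonalEqBot
    (v := fun j => Complex.exp (Complex.I * θ * en j) • Φ j)
    (by
      classical
      have hΦ := orthonormal_iff_ite.mp Φ.orthonormal
      rw [orthonormal_iff_ite]
      intro i j
      rw [inner_smul_left, inner_smul_right, hΦ]
      split_ifs with h
      · subst h
        rw [mul_one, ← Complex.exp_conj, ← Complex.exp_add]
        simp
      · simp)
    (by
      rw [Submodule.eq_bot_iff]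
      intro x hx
      have h0 : ∀ j, inner ℂ (Φ j) x = 0 := by
        intro j
        have h1 := (Submodule.mem_orthogonal _ x).mp hx _
          (Submodule.subset_span (Set.mem_range_self j))
        rw [inner_smul_left, mul_eq_zero] at h1
        rcases h1 with h1 | h1
        · exact absurd h1 (by simp [Complex.exp_ne_zero])
        · exact h1
      have h2 : Φ.repr x = 0 := by
        ext j
        rw [Φ.repr_apply_apply, h0 j]
        rfl
      simpa using h2)

/-- The unitary operator `e^{i θ H₀}`. -/
def freeExp (Φ : HilbertBasis ι ℂ E) (en : ι → ℝ) (θ : ℝ) : E →L[ℂ] E :=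
  ((Φ.repr.trans (rotatedBasis Φ en θ).repr.symm).toContinuousLinearEquiv : E →L[ℂ] E)

/-- `e^{i θ H₀}` acts on the eigenvectors of `H₀` as it should. -/
theorem freeExp_apply_basis (Φ : HilbertBasis ι ℂ E) (en : ι → ℝ) (θ : ℝ) (j : ι) :
    freeExp Φ en θ (Φ j) = Complex.exp (Complex.I * θ * en j) • Φ j := by
  classical
  have h : (rotatedBasis Φ en θ) j = Complex.exp (Complex.I * θ * en j) • Φ j := by
    simp [rotatedBasis]
  rw [← h]
  change (rotatedBasis Φ en θ).repr.symm (Φ.repr (Φ j)) = _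
  rw [HilbertBasis.repr_self, HilbertBasis.repr_symm_single]

/-- The eigenspace of `H₀` for `E₀`: the vectors `x` with `⟨Φ i, H₀ x⟩ = E₀ ⟨Φ i, x⟩` for
all `i`. -/
def eigenspace (Φ : HilbertBasis ι ℂ E) (en : ι → ℝ) (E₀ : ℝ) : Submodule ℂ E where
  carrier := {x | ∀ i, (en i : ℂ) * inner ℂ (Φ i) x = (E₀ : ℂ) * inner ℂ (Φ i) x}
  zero_mem' := by simp
  add_mem' := by
    intro x y hx hy i
    simp only [inner_add_right, mul_add, hx i, hy i]
  smul_mem' := by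
    intro c x hx i
    simp only [inner_smul_right, mul_left_comm _ c, hx i]

instance (Φ : HilbertBasis ι ℂ E) (en : ι → ℝ) (E₀ : ℝ) :
    CompleteSpace (eigenspace Φ en E₀) := by
  have h : IsClosed (eigenspace Φ en E₀ : Set E) := by
    have : (eigenspace Φ en E₀ : Set E) =
        ⋂ i, {x | (en i : ℂ) * inner ℂ (Φ i) x = (E₀ : ℂ) * inner ℂ (Φ i) x} := by
      ext x
      simp [eigenspace]
    rw [this]
    exact isClosed_iInter fun i => isClosed_eq (by fun_prop) (by fun_prop)
  exact h.completeSpace_coe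

/-- The orthogonal projection `P` on the eigenspace of `H₀` for `E₀`. -/
def eigenProj (Φ : HilbertBasis ι ℂ E) (en : ι → ℝ) (E₀ : ℝ) : E →L[ℂ] E :=
  (eigenspace Φ en E₀).starProjection

/-- `e^{i t H₀} V e^{-i t H₀} e^{-ε |t|}`, the perturbation in the interaction representation. -/
def interaction (Φ : HilbertBasis ι ℂ E) (en : ι → ℝ) (V : E →L[ℂ] E) (ε t : ℝ) : E →L[ℂ] E :=
  (Real.exp (-ε * |t|) : ℂ) • (freeExp Φ en t * V * freeExp Φ en (-t))

/-- `H_i(t)`: the interaction multiplied by `-i`. -/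
def Hi (Φ : HilbertBasis ι ℂ E) (en : ι → ℝ) (V : E →L[ℂ] E) (ε t : ℝ) : E →L[ℂ] E :=
  (-Complex.I) • interaction Φ en V ε t

/-- `U` is the evolution operator `U_ε`: it solves `i ∂U(t)/∂t = H_I(t) U(t)` with `U(-∞) = 1`
(derivative and limit in the strong sense, that is on every vector). -/
structure IsEvolution (Φ : HilbertBasis ι ℂ E) (en : ι → ℝ) (V : E →L[ℂ] E) (ε : ℝ)
    (U : ℝ → E →L[ℂ] E) : Prop where
  schrodinger : ∀ (x : E) (t : ℝ), ∃ d : E, HasDerivAt (fun s => U s x) d t ∧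
    Complex.I • d = interaction Φ en V ε t (U t x)
  initial : ∀ x : E, Tendsto (fun t => U t x) atBot (𝓝 x)

/-! ### Iterated integrals -/

/-- `S` is the integral of the operator-valued function `f`, in the strong sense (on every
vector). -/
def IsStrongIntegral {α : Type*} [MeasurableSpace α] (μ : Measure α) (f : α → E →L[ℂ] E)
    (S : E →L[ℂ] E) : Prop :=
  ∀ x, Integrable (fun a => f a x) μ ∧ S x = ∫ a, f a x ∂μ

open Classical in
/-- The strong integral of an operator-valued function (`0` if there is none). -/
def strongIntegral {α : Type*} [MeasurableSpace α] (μ : Measure α) (f : α → E →L[ℂ] E) :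
    E →L[ℂ] E :=
  if h : ∃ S, IsStrongIntegral μ f S then h.choose else 0

/-- The simplex `-∞ < t_n ≤ … ≤ t_1 ≤ 0`. -/
def simplex (n : ℕ) : Set (Fin n → ℝ) := {t | Antitone t ∧ ∀ i, t i ≤ 0}

/-- The Picard term: the integral of `H(t_1) … H(t_n)` over the simplex. -/
def picardTerm (H : ℝ → E →L[ℂ] E) (n : ℕ) : E →L[ℂ] E :=
  strongIntegral (volume.restrict (simplex n)) fun t => (List.ofFn fun i => H (t i)).prod

/-- The iterated integral `⟨s⟩` of a signed permutation `s` with values `σ(1), …, σ(n)`: the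
integral over the simplex of `X(t_{σ(1)}) … X(t_{σ(n)})`, where the `i`-th factor uses `B` if the
`i`-th entry of `s` has a bar and `A` otherwise. -/
def bracket (A B : ℝ → E →L[ℂ] E) {n : ℕ} (s : SignedPerm n) : E →L[ℂ] E :=
  strongIntegral (volume.restrict (simplex n)) fun t =>
    (List.ofFn fun i => (if s.bar i then B else A) (t (s.perm i))).prod

/-- The linear extension of `⟨·⟩` to `ℚ[B_n]`. -/
def bracketLin (A B : ℝ → E →L[ℂ] E) {n : ℕ} (γ : SignedPerm n →₀ ℚ) : E →L[ℂ] E :=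
  γ.sum fun s c => (c : ℂ) • bracket A B s

/-- `⟨R_∅^n⟩` for the operators `A = (1 - P) H_i` and `B = -P H_i`. -/
def regBracket (P : E →L[ℂ] E) (H : ℝ → E →L[ℂ] E) (n : ℕ) : E →L[ℂ] E :=
  bracketLin (fun t => (1 - P) * H t) (fun t => -(P * H t)) (regressionSum n ∅)

/-- The series `∑_n f n` of operators converges strongly, with sum `S`: on every vector, its
partial sums (in the given order) converge. -/
def StrongSum (f : ℕ → E →L[ℂ] E) (S : E →L[ℂ] E) : Prop :=
  ∀ x, Tendsto (fun N => ∑ n ∈ Finset.range N, f n x) atTop (𝓝 (S x))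

/-- `F ε` converges strongly to `W` as `ε → 0`, `ε > 0`. -/
def StrongLim (F : ℝ → E →L[ℂ] E) (W : E →L[ℂ] E) : Prop :=
  ∀ x, Tendsto (fun ε => F ε x) (𝓝[>] 0) (𝓝 (W x))

/-! ### The formal series in the coupling constant

Replacing `V` by `lam • V` multiplies every `n`-fold iterated integral by `lam ^ n`; the formal
series below are the resulting series in `lam`, with operator coefficients. -/

/-- The Picard expansion of `U_ε(0)` as a formal series in the coupling constant. -/
def formalPicard (H : ℝ → E →L[ℂ] E) : PowerSeries (E →L[ℂ] E) :=
  PowerSeries.mk (picardTerm H)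

/-- `∑_{n ≥ 1} ⟨R_∅^n⟩` as a formal series in the coupling constant. -/
def formalReg (P : E →L[ℂ] E) (H : ℝ → E →L[ℂ] E) : PowerSeries (E →L[ℂ] E) :=
  PowerSeries.mk fun n => if n = 0 then 0 else regBracket P H n

end Operators

end

end HyperPicard

namespace HyperPicard

noncomputable section

section Operators

variable {E : Type*} [NormedAddCommGroup E] [InnerProductSpace ℂ E]

/-! ### Strong integrals -/

/-! Write `A = (1 - P) H` and `B = -P H`, so that `A - B = H`. Let `k(s, u)` be `A u` if `u ≤ s` and
`B u` otherwise, and let `G_n(s)` be the integral of `k(s, t₁) k(t₁, t₂) ⋯ k(tₙ₋₁, tₙ)` over `(-∞,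
0]ⁿ` (`iterInt`).

Combinatorics. For distinct times, the ordering determines the permutation, and absence of
regressions then determines every bar but the first: a bar marks a step to a later time. Left
multiplication by `1 - P` kills `B` and fixes `A`, so only the term with unbarred first entry
survives, and it equals the kernel product with `s = 0`. Hence `(1 - P) ⟨R_∅^n⟩ = G_n(0)` for `n ≥
1` (`mul_sum_barProd_eq`, `mul_regBracket_succ_eq`).

Analysis. Since `k(s, u) = B u + 1_{u ≤ s} H u`, one has `G_{n+1}(s) = c_{n+1} + ∫_{-∞}^s H G_n`,
where `c_n` is the value of `G_n` at `-∞` (`iterIntBot`). So the series of the `G_n` solves the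
evolution equation with initial value `c`, and therefore equals the Picard series times `c`
(`iterInt_eq_sum_antidiagonal`). At `s = 0` this reads `𝒰 c = 1 + (1 - P) ℛ`
(`formalPicard_mul_formalBot`).

Algebra. Multiplying by `P` gives `P 𝒰 c = P`, and `c P = P c P` because every `c_n` with `n ≥ 1`
begins with `-P H`. So `c P` inverts `P 𝒰 P` on the image of `P`, and `𝒰 P (P 𝒰 P)⁻¹ = 𝒰 c P = P +
(1 - P) ℛ P`.

For operators, `𝒰 P = (P + (1 - P) ℛ P) (P 𝒰 P)` is summed as a Cauchy product of a strongly
convergent and an absolutely convergent series (`hasSum_mul_of_strongSum`); no convergence of `c` is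
needed. -/

theorem IsStrongIntegral.unique {α : Type*} [MeasurableSpace α] {μ : Measure α}
    {f : α → E →L[ℂ] E} {S T : E →L[ℂ] E} (hS : IsStrongIntegral μ f S)
    (hT : IsStrongIntegral μ f T) : S = T := by
  ext x
  rw [(hS x).2, (hT x).2]

theorem IsStrongIntegral.strongIntegral_eq {α : Type*} [MeasurableSpace α] {μ : Measure α}
    {f : α → E →L[ℂ] E} {S : E →L[ℂ] E} (hS : IsStrongIntegral μ f S) :
    strongIntegral μ f = S := by
  have h : ∃ S, IsStrongIntegral μ f S := ⟨S, hS⟩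
  rw [strongIntegral, dif_pos h]
  exact h.choose_spec.unique hS

/-- A strongly measurable family of operators with an integrable bound has a strong integral. -/
theorem isStrongIntegral_strongIntegral {α : Type*} [MeasurableSpace α] {μ : Measure α}
    {f : α → E →L[ℂ] E} {g : α → ℝ} (hf : ∀ x, AEStronglyMeasurable (fun a => f a x) μ)
    (hg : Integrable g μ) (hfg : ∀ᵐ a ∂μ, ‖f a‖ ≤ g a) :
    IsStrongIntegral μ f (strongIntegral μ f) := by
  have hle : ∀ x, ∀ᵐ a ∂μ, ‖f a x‖ ≤ g a * ‖x‖ := fun x =>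
    hfg.mono fun a ha => (f a).le_of_opNorm_le ha x
  have hint : ∀ x, Integrable (fun a => f a x) μ := fun x =>
    (hg.mul_const ‖x‖).mono' (hf x) (hle x)
  let S : E →L[ℂ] E := LinearMap.mkContinuous
    { toFun := fun x => ∫ a, f a x ∂μ
      map_add' := fun x y => by
        simp only [map_add]
        exact integral_add (hint x) (hint y)
      map_smul' := fun c x => by
        simp only [map_smul, RingHom.id_apply]
        exact integral_smul c _ } (∫ a, g a ∂μ) fun x => by
        rw [← integral_mul_const]
        exact norm_integral_le_of_norm_le (hg.mul_const _) (hle x)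
  have hS : IsStrongIntegral μ f S := fun x => ⟨hint x, rfl⟩
  rw [hS.strongIntegral_eq]
  exact hS

theorem IsStrongIntegral.norm_le {α : Type*} [MeasurableSpace α] {μ : Measure α}
    {f : α → E →L[ℂ] E} {g : α → ℝ} {S : E →L[ℂ] E} (hS : IsStrongIntegral μ f S)
    (hg : Integrable g μ) (hfg : ∀ᵐ a ∂μ, ‖f a‖ ≤ g a) : ‖S‖ ≤ ∫ a, g a ∂μ := by
  refine S.opNorm_le_bound (integral_nonneg_of_ae
    (hfg.mono fun a ha => (norm_nonneg _).trans ha)) fun x => ?_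
  rw [(hS x).2, ← integral_mul_const]
  exact norm_integral_le_of_norm_le (hg.mul_const _)
    (hfg.mono fun a ha => (f a).le_of_opNorm_le ha x)

/-! ### Strongly continuous families with exponential decay at `-∞` -/

/-- A bounded, strongly continuous family of operators that decays like `e^{ε t}` at `-∞`. -/
structure IsDecaying (C ε : ℝ) (X : ℝ → E →L[ℂ] E) : Prop where
  continuous_apply : ∀ x, Continuous fun t => X t x
  norm_le : ∀ t, ‖X t‖ ≤ C
  norm_le_exp : ∀ t ≤ 0, ‖X t‖ ≤ C * Real.exp (ε * t)

namespace IsDecaying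

variable {C ε : ℝ} {X Y : ℝ → E →L[ℂ] E}

theorem const_nonneg (hX : IsDecaying C ε X) : 0 ≤ C := (norm_nonneg _).trans (hX.norm_le 0)

/-- The uniform norm bound upgrades strong continuity to joint continuity. This gives measurability
of `u ↦ X u (f u)`, although `X` need not be continuous in norm. -/
theorem continuous_uncurry (hX : IsDecaying C ε X) : Continuous fun p : ℝ × E => X p.1 p.2 := by
  rw [continuous_iff_continuousAt]
  rintro ⟨t, x⟩
  rw [ContinuousAt, tendsto_iff_norm_sub_tendsto_zero]
  have h1 : Tendsto (fun p : ℝ × E => C * ‖p.2 - x‖ + ‖X p.1 x - X t x‖) (𝓝 (t, x)) (𝓝 0) := by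
    have : Continuous fun p : ℝ × E => C * ‖p.2 - x‖ + ‖X p.1 x - X t x‖ := by
      have h := (hX.continuous_apply x).comp (continuous_fst : Continuous (Prod.fst : ℝ × E → ℝ))
      exact (continuous_const.mul (continuous_snd.sub continuous_const).norm).add
        (h.sub continuous_const).norm
    simpa using this.tendsto (t, x)
  refine squeeze_zero (fun _ => norm_nonneg _) (fun p => ?_) h1
  calc ‖X p.1 p.2 - X t x‖ = ‖X p.1 (p.2 - x) + (X p.1 x - X t x)‖ := by
        rw [map_sub]; congr 1; abel
    _ ≤ ‖X p.1 (p.2 - x)‖ + ‖X p.1 x - X t x‖ := norm_add_le _ _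
    _ ≤ _ := by gcongr; exact (X p.1).le_of_opNorm_le (hX.norm_le _) _

theorem mul_left (hX : IsDecaying C ε X) {T : E →L[ℂ] E} (hT : ‖T‖ ≤ 1) :
    IsDecaying C ε fun t => T * X t where
  continuous_apply x := T.continuous.comp (hX.continuous_apply x)
  norm_le t := (norm_mul_le _ _).trans <|
    (mul_le_of_le_one_left (norm_nonneg _) hT).trans (hX.norm_le t)
  norm_le_exp t ht := (norm_mul_le _ _).trans <|
    (mul_le_of_le_one_left (norm_nonneg _) hT).trans (hX.norm_le_exp t ht)

theorem neg (hX : IsDecaying C ε X) : IsDecaying C ε fun t => -X t where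
  continuous_apply x := (hX.continuous_apply x).neg
  norm_le t := by simpa using hX.norm_le t
  norm_le_exp t ht := by simpa using hX.norm_le_exp t ht

end IsDecaying

theorem isDecaying_zero {C ε : ℝ} (hC : 0 ≤ C) : IsDecaying C ε (fun _ => (0 : E →L[ℂ] E)) where
  continuous_apply x := by simpa using continuous_const
  norm_le t := by simpa using hC
  norm_le_exp t ht := by rw [norm_zero]; positivity

/-! ### Iterated integrals with a two-sided kernel -/

/-- The kernel that equals `X u` for `u ≤ s` and `Y u` for `u > s`. -/
def kernel (X Y : ℝ → E →L[ℂ] E) (s u : ℝ) : E →L[ℂ] E := if u ≤ s then X u else Y u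

/-- The iterated integrals over `(-∞, 0]` of the kernel, in the order
`k(s, u₁) k(u₁, u₂) ⋯ k(uₙ₋₁, uₙ)`. -/
def iterInt (X Y : ℝ → E →L[ℂ] E) : ℕ → ℝ → E →L[ℂ] E
  | 0, _ => 1
  | n + 1, s => strongIntegral (volume.restrict (Set.Iic 0)) fun u =>
      kernel X Y s u * iterInt X Y n u

variable {C ε : ℝ} {X Y : ℝ → E →L[ℂ] E}

theorem norm_kernel_le_exp (hX : IsDecaying C ε X) (hY : IsDecaying C ε Y) (s : ℝ) {u : ℝ}
    (hu : u ≤ 0) : ‖kernel X Y s u‖ ≤ C * Real.exp (ε * u) := by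
  unfold kernel
  split_ifs
  exacts [hX.norm_le_exp u hu, hY.norm_le_exp u hu]

theorem integrableOn_const_mul_exp (hε : 0 < ε) (C s : ℝ) :
    IntegrableOn (fun u => C * Real.exp (ε * u)) (Set.Iic s) :=
  (integrableOn_exp_mul_Iic hε s).const_mul C

theorem stronglyMeasurable_kernel_apply {α : Type*} [MeasurableSpace α]
    (hX : IsDecaying C ε X) (hY : IsDecaying C ε Y) {s u : α → ℝ} {F : α → E}
    (hs : Measurable s) (hu : Measurable u) (hF : StronglyMeasurable F) :
    StronglyMeasurable fun a => kernel X Y (s a) (u a) (F a) := by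
  have h : ∀ {Z : ℝ → E →L[ℂ] E}, IsDecaying C ε Z → StronglyMeasurable fun a => Z (u a) (F a) :=
    fun hZ => hZ.continuous_uncurry.comp_stronglyMeasurable (hu.stronglyMeasurable.prodMk hF)
  have : (fun a => kernel X Y (s a) (u a) (F a)) =
      fun a => if u a ≤ s a then X (u a) (F a) else Y (u a) (F a) := by
    funext a
    unfold kernel
    split_ifs <;> rfl
  rw [this]
  exact StronglyMeasurable.ite (measurableSet_le hu hs) (h hX) (h hY)

theorem isStrongIntegral_kernel_mul (hε : 0 < ε) (hX : IsDecaying C ε X) (hY : IsDecaying C ε Y)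
    {G : ℝ → E →L[ℂ] E} (hG : ∀ x, Continuous fun u => G u x) {M : ℝ} (hM : ∀ u, ‖G u‖ ≤ M)
    (s : ℝ) :
    IsStrongIntegral (volume.restrict (Set.Iic 0)) (fun u => kernel X Y s u * G u)
      (strongIntegral (volume.restrict (Set.Iic 0)) fun u => kernel X Y s u * G u) :=
  isStrongIntegral_strongIntegral
    (fun x => (stronglyMeasurable_kernel_apply hX hY measurable_const measurable_id
      (hG x).stronglyMeasurable).aestronglyMeasurable)
    ((integrableOn_const_mul_exp hε C 0).mul_const M)
    ((ae_restrict_mem measurableSet_Iic).mono fun u hu => (norm_mul_le _ _).trans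
      (mul_le_mul (norm_kernel_le_exp hX hY s hu) (hM u) (norm_nonneg _)
        (mul_nonneg hX.const_nonneg (Real.exp_pos _).le)))

/-- Both properties go through one induction, since together they guarantee that the next integral
exists. Continuity in `s` is dominated convergence. -/
theorem continuous_iterInt_apply_and_bounded (hε : 0 < ε) (hX : IsDecaying C ε X)
    (hY : IsDecaying C ε Y) (n : ℕ) :
    (∀ x, Continuous fun s => iterInt X Y n s x) ∧ ∃ M, ∀ s, ‖iterInt X Y n s‖ ≤ M := by
  induction n with
  | zero => exact ⟨fun x => continuous_const, 1, fun s => ContinuousLinearMap.norm_id_le⟩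
  | succ n ih =>
    obtain ⟨hG, M, hM⟩ := ih
    have hC := hX.const_nonneg
    have hint := (integrableOn_const_mul_exp hε C 0).mul_const M
    have hle : ∀ s, ∀ᵐ u ∂volume.restrict (Set.Iic (0 : ℝ)),
        ‖kernel X Y s u * iterInt X Y n u‖ ≤ C * Real.exp (ε * u) * M := fun s =>
      (ae_restrict_mem measurableSet_Iic).mono fun u hu => (norm_mul_le _ _).trans
        (mul_le_mul (norm_kernel_le_exp hX hY s hu) (hM u) (norm_nonneg _)
          (mul_nonneg hC (Real.exp_pos _).le))
    refine ⟨fun x => ?_, _, fun s =>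
      (isStrongIntegral_kernel_mul hε hX hY hG hM s).norm_le hint (hle s)⟩
    have heq : (fun s => iterInt X Y (n + 1) s x) = fun s =>
        ∫ u in Set.Iic 0, kernel X Y s u (iterInt X Y n u x) := by
      funext s
      exact (isStrongIntegral_kernel_mul hε hX hY hG hM s x).2
    rw [heq, continuous_iff_continuousAt]
    intro s₀
    refine continuousAt_of_dominated
      (Eventually.of_forall fun s => (isStrongIntegral_kernel_mul hε hX hY hG hM s x).1.1)
      (Eventually.of_forall fun s => (hle s).mono fun u hu =>
        (kernel X Y s u * iterInt X Y n u).le_of_opNorm_le hu x)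
      (hint.mul_const ‖x‖) ?_
    -- For fixed `u`, the kernel jumps in `s` only at `s = u`, so continuity at `s₀` fails at most
    -- on the null set `u = s₀`.
    have hne : ∀ᵐ u ∂volume.restrict (Set.Iic (0 : ℝ)), u ≠ s₀ :=
      ae_restrict_of_ae (by simp [ae_iff])
    filter_upwards [hne] with u hu
    rcases lt_or_gt_of_ne hu with h | h
    · refine (continuousAt_const (y := X u (iterInt X Y n u x))).congr ?_
      filter_upwards [lt_mem_nhds h] with s hs
      rw [kernel, if_pos hs.le]
    · refine (continuousAt_const (y := Y u (iterInt X Y n u x))).congr ?_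
      filter_upwards [gt_mem_nhds h] with s hs
      rw [kernel, if_neg (not_le.mpr hs)]

theorem isStrongIntegral_iterInt_succ (hε : 0 < ε) (hX : IsDecaying C ε X)
    (hY : IsDecaying C ε Y) (n : ℕ) (s : ℝ) :
    IsStrongIntegral (volume.restrict (Set.Iic 0)) (fun u => kernel X Y s u * iterInt X Y n u)
      (iterInt X Y (n + 1) s) := by
  obtain ⟨hG, M, hM⟩ := continuous_iterInt_apply_and_bounded hε hX hY n
  exact isStrongIntegral_kernel_mul hε hX hY hG hM s

/-- The limit at `-∞` of the iterated integrals. -/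
def iterIntBot (X Y : ℝ → E →L[ℂ] E) : ℕ → E →L[ℂ] E
  | 0 => 1
  | n + 1 => strongIntegral (volume.restrict (Set.Iic 0)) fun u => Y u * iterInt X Y n u

theorem isStrongIntegral_iterIntBot_succ (hε : 0 < ε) (hX : IsDecaying C ε X)
    (hY : IsDecaying C ε Y) (n : ℕ) :
    IsStrongIntegral (volume.restrict (Set.Iic 0)) (fun u => Y u * iterInt X Y n u)
      (iterIntBot X Y (n + 1)) := by
  obtain ⟨hG, M, hM⟩ := continuous_iterInt_apply_and_bounded hε hX hY n
  -- With both branches equal to `Y`, the kernel is `Y u` and the parameter `0` is immaterial.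
  have h := isStrongIntegral_kernel_mul hε hY hY hG hM 0
  simp only [kernel, ite_self] at h
  exact h

theorem integrableOn_apply (hε : 0 < ε) (hX : IsDecaying C ε X) {f : ℝ → E}
    (hf : Continuous f) {M : ℝ} (hM : ∀ u ≤ 0, ‖f u‖ ≤ M) :
    IntegrableOn (fun u => X u (f u)) (Set.Iic 0) := by
  refine ((integrableOn_const_mul_exp hε C 0).mul_const M).mono'
    (hX.continuous_uncurry.comp (continuous_id.prodMk hf)).aestronglyMeasurable
    ((ae_restrict_mem measurableSet_Iic).mono fun u hu => ?_)
  exact ((X u).le_of_opNorm_le (hX.norm_le_exp u hu) _).trans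
    (mul_le_mul_of_nonneg_left (hM u hu) (mul_nonneg hX.const_nonneg (Real.exp_pos _).le))

/-- The kernel is `Y u` plus the indicator of `u ≤ s` times `X u - Y u`; thus the dependence on `s`
is that of a Volterra integral with integrand `X - Y`. -/
theorem iterInt_succ_apply_eq (hε : 0 < ε) (hX : IsDecaying C ε X) (hY : IsDecaying C ε Y)
    (n : ℕ) {s : ℝ} (hs : s ≤ 0) (x : E) :
    iterInt X Y (n + 1) s x = iterIntBot X Y (n + 1) x +
      ∫ u in Set.Iic s, (X u - Y u) (iterInt X Y n u x) := by
  obtain ⟨hG, M, hM⟩ := continuous_iterInt_apply_and_bounded hε hX hY n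
  have hb : ∀ u ≤ (0 : ℝ), ‖iterInt X Y n u x‖ ≤ M * ‖x‖ :=
    fun u _ => (iterInt X Y n u).le_of_opNorm_le (hM u) x
  have h1 := integrableOn_apply hε hX (hG x) hb
  have h2 := integrableOn_apply hε hY (hG x) hb
  rw [(isStrongIntegral_iterInt_succ hε hX hY n s x).2,
    (isStrongIntegral_iterIntBot_succ hε hX hY n x).2]
  have h3 : ∫ u in Set.Iic s, (X u - Y u) (iterInt X Y n u x) =
      ∫ u in Set.Iic 0, (Set.Iic s).indicator
        (fun u => (X u - Y u) (iterInt X Y n u x)) u := by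
    rw [setIntegral_indicator measurableSet_Iic, Set.inter_eq_right.mpr (Set.Iic_subset_Iic.mpr hs)]
  rw [h3, ← integral_add]
  · congr 1
    funext u
    by_cases hu : u ≤ s
    · simp [kernel, hu]
    · simp [kernel, hu]
  · exact h2
  · exact (h1.sub h2).indicator measurableSet_Iic

end Operators

section Operators

variable {E : Type*} [NormedAddCommGroup E] [InnerProductSpace ℂ E]
variable {C ε : ℝ} {H X Y : ℝ → E →L[ℂ] E}

/-! ### The Picard expansion -/

/-- One Volterra step: the decay of `H` raises the exponent to `(n + 1) ε u`, and integrating it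
yields the factor `1 / ((n + 1) ε)` that builds up the factorial. -/
theorem norm_setIntegral_Iic_apply_le (hε : 0 < ε) (hH : IsDecaying C ε H) {f : ℝ → E} {M : ℝ}
    {n : ℕ} (hf : ∀ u ≤ 0, ‖f u‖ ≤ M * ((C / ε) ^ n * Real.exp (n * ε * u) / n.factorial))
    {s : ℝ} (hs : s ≤ 0) :
    ‖∫ u in Set.Iic s, H u (f u)‖ ≤
      M * ((C / ε) ^ (n + 1) * Real.exp ((n + 1 : ℕ) * ε * s) / (n + 1).factorial) := by
  have hε' : 0 < (n + 1 : ℕ) * ε := by positivity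
  have hint : IntegrableOn (fun u => C * M * (C / ε) ^ n / n.factorial *
      Real.exp ((n + 1 : ℕ) * ε * u)) (Set.Iic s) := integrableOn_const_mul_exp hε' _ s
  refine (norm_integral_le_of_norm_le hint
    ((ae_restrict_mem measurableSet_Iic).mono fun u hu => ?_)).trans_eq ?_
  · have hu0 : u ≤ 0 := le_trans hu hs
    refine ((H u).le_of_opNorm_le (hH.norm_le_exp u hu0) _).trans ((mul_le_mul_of_nonneg_left
      (hf u hu0) (mul_nonneg hH.const_nonneg (Real.exp_pos _).le)).trans_eq ?_)
    have : Real.exp ((n + 1 : ℕ) * ε * u) = Real.exp (ε * u) * Real.exp (n * ε * u) := by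
      rw [← Real.exp_add]; congr 1; push_cast; ring
    rw [this]
    ring
  · rw [integral_const_mul, integral_exp_mul_Iic hε', Nat.factorial_succ]
    push_cast
    have : (n.factorial : ℝ) ≠ 0 := by positivity
    rw [pow_succ (C / ε)]
    field_simp

theorem iterIntBot_zero_right_succ (H : ℝ → E →L[ℂ] E) (n : ℕ) :
    iterIntBot H (fun _ => 0) (n + 1) = 0 := by
  refine IsStrongIntegral.strongIntegral_eq fun x => ?_
  simp

theorem iterInt_zero_right_succ_apply (hε : 0 < ε) (hH : IsDecaying C ε H) (n : ℕ) {s : ℝ}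
    (hs : s ≤ 0) (x : E) :
    iterInt H (fun _ => 0) (n + 1) s x =
      ∫ u in Set.Iic s, H u (iterInt H (fun _ => 0) n u x) := by
  rw [iterInt_succ_apply_eq hε hH (isDecaying_zero hH.const_nonneg) n hs,
    iterIntBot_zero_right_succ]
  simp

theorem norm_iterInt_zero_right_le (hε : 0 < ε) (hH : IsDecaying C ε H) (n : ℕ) :
    ∀ s ≤ (0 : ℝ), ‖iterInt H (fun _ => 0) n s‖ ≤
      (C / ε) ^ n * Real.exp (n * ε * s) / n.factorial := by
  have hC := hH.const_nonneg
  induction n with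
  | zero => intro s _; simpa [iterInt, ContinuousLinearMap.one_def] using (ContinuousLinearMap.norm_id_le : ‖ContinuousLinearMap.id ℂ E‖ ≤ 1)
  | succ n ih =>
    intro s hs
    refine ContinuousLinearMap.opNorm_le_bound _ (by positivity) fun x => ?_
    rw [iterInt_zero_right_succ_apply hε hH n hs, mul_comm]
    refine norm_setIntegral_Iic_apply_le hε hH (fun u hu => ?_) hs
    rw [mul_comm]
    exact (iterInt H (fun _ => 0) n u).le_of_opNorm_le (ih u hu) x

theorem summable_norm_iterInt_zero_right (hε : 0 < ε) (hH : IsDecaying C ε H) :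
    Summable fun n => ‖iterInt H (fun _ => 0) n 0‖ :=
  (Real.summable_pow_div_factorial (C / ε)).of_nonneg_of_le (fun _ => norm_nonneg _) fun n => by
    simpa using norm_iterInt_zero_right_le hε hH n 0 le_rfl

/-- The remainder of order `n + 1` is the Volterra operator applied to the remainder of order `n`,
so the one-step estimate iterates from `‖U‖ ≤ M`. -/
theorem norm_sub_sum_iterInt_le (hε : 0 < ε) (hH : IsDecaying C ε H) {U : ℝ → E} {x : E}
    (hcont : Continuous U)
    (hU : ∀ s ≤ 0, U s = x + ∫ u in Set.Iic s, H u (U u)) {M : ℝ} (hM : ∀ u ≤ 0, ‖U u‖ ≤ M)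
    (n : ℕ) : ∀ s ≤ 0, ‖U s - ∑ k ∈ Finset.range n, iterInt H (fun _ => 0) k s x‖ ≤
      M * ((C / ε) ^ n * Real.exp (n * ε * s) / n.factorial) := by
  have h0 : IsDecaying C ε (fun _ => (0 : E →L[ℂ] E)) := isDecaying_zero hH.const_nonneg
  induction n with
  | zero => intro s hs; simpa using hM s hs
  | succ n ih =>
    intro s hs
    have key : U s - ∑ k ∈ Finset.range (n + 1), iterInt H (fun _ => 0) k s x =
        ∫ u in Set.Iic s, H u (U u - ∑ k ∈ Finset.range n, iterInt H (fun _ => 0) k u x) := by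
      have hi : ∀ k, IntegrableOn (fun u => H u (iterInt H (fun _ => 0) k u x)) (Set.Iic s) := by
        intro k
        obtain ⟨hG, N, hN⟩ := continuous_iterInt_apply_and_bounded hε hH h0 k
        exact (integrableOn_apply hε hH (hG x) (M := N * ‖x‖) fun u _ =>
          (iterInt H (fun _ => 0) k u).le_of_opNorm_le (hN u) x).mono_set
            (Set.Iic_subset_Iic.mpr hs)
      have hiU : IntegrableOn (fun u => H u (U u)) (Set.Iic s) :=
        (integrableOn_apply hε hH hcont hM).mono_set (Set.Iic_subset_Iic.mpr hs)
      simp only [map_sub, map_sum]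
      rw [integral_sub hiU (integrable_finsetSum _ fun k _ => hi k),
        integral_finsetSum _ fun k _ => hi k, Finset.sum_range_succ', hU s hs]
      simp only [iterInt_zero_right_succ_apply hε hH _ hs]
      simp only [iterInt, one_apply_eq_self]
      abel
    rw [key]
    exact norm_setIntegral_Iic_apply_le hε hH ih hs

/-- The terms are summable in norm by themselves; the sum is identified vector by vector, so the
bound on `U u x` may depend on `x`. -/
theorem hasSum_iterInt_of_integral_eq [CompleteSpace E] (hε : 0 < ε) (hH : IsDecaying C ε H)
    {U : ℝ → E →L[ℂ] E} (hcont : ∀ x, Continuous fun s => U s x)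
    (hU : ∀ x, ∀ s ≤ 0, U s x = x + ∫ u in Set.Iic s, H u (U u x))
    (hM : ∀ x, ∃ M, ∀ u ≤ 0, ‖U u x‖ ≤ M) :
    HasSum (fun n => iterInt H (fun _ => 0) n 0) (U 0) := by
  have hs : Summable fun n => iterInt H (fun _ => 0) n 0 :=
    (summable_norm_iterInt_zero_right hε hH).of_norm
  convert hs.hasSum using 1
  ext x
  obtain ⟨M, hM⟩ := hM x
  have h1 : Tendsto (fun n => ∑ k ∈ Finset.range n, iterInt H (fun _ => 0) k 0 x) atTop
      (𝓝 ((∑' n, iterInt H (fun _ => 0) n 0) x)) := by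
    have := ((ContinuousLinearMap.apply ℂ E x).hasSum hs.hasSum).tendsto_sum_nat
    exact this
  refine tendsto_nhds_unique ?_ h1
  rw [tendsto_iff_norm_sub_tendsto_zero]
  have h2 : Tendsto (fun n : ℕ => M * ((C / ε) ^ n / n.factorial)) atTop (𝓝 0) := by
    simpa using (FloorSemiring.tendsto_pow_div_factorial_atTop (C / ε)).const_mul M
  refine squeeze_zero (fun _ => norm_nonneg _) (fun n => ?_) h2
  rw [norm_sub_rev]
  simpa using norm_sub_sum_iterInt_le hε hH (hcont x) (hU x) hM n 0 le_rfl

/-! ### Factorization through the limit at `-∞` -/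

/-- Both sides satisfy the same Volterra recursion in `s` with integrand `H = X - Y` and the same
value at `-∞`. This is uniqueness for the evolution equation, order by order. -/
theorem iterInt_apply_eq_sum_antidiagonal (hε : 0 < ε) (hX : IsDecaying C ε X)
    (hY : IsDecaying C ε Y) (hH : IsDecaying C ε H) (hXY : ∀ u, X u - Y u = H u) (n : ℕ) :
    ∀ s ≤ (0 : ℝ), ∀ x, iterInt X Y n s x = ∑ p ∈ Finset.HasAntidiagonal.antidiagonal n,
      iterInt H (fun _ => 0) p.1 s (iterIntBot X Y p.2 x) := by
  have h0 : IsDecaying C ε (fun _ => (0 : E →L[ℂ] E)) := isDecaying_zero hH.const_nonneg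
  induction n with
  | zero => intro s _ x; simp [iterInt, iterIntBot]
  | succ n ih =>
    intro s hs x
    have hi : ∀ k y, IntegrableOn (fun u => H u (iterInt H (fun _ => 0) k u y)) (Set.Iic s) := by
      intro k y
      obtain ⟨hG, N, hN⟩ := continuous_iterInt_apply_and_bounded hε hH h0 k
      exact (integrableOn_apply hε hH (hG y) (M := N * ‖y‖) fun u _ =>
        (iterInt H (fun _ => 0) k u).le_of_opNorm_le (hN u) y).mono_set
          (Set.Iic_subset_Iic.mpr hs)
    rw [iterInt_succ_apply_eq hε hX hY n hs, Finset.Nat.sum_antidiagonal_succ]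
    simp only [iterInt_zero_right_succ_apply hε hH _ hs]
    rw [← integral_finsetSum _ fun p _ => hi _ _]
    congr 1
    refine setIntegral_congr_fun measurableSet_Iic fun u hu => ?_
    simp only [hXY, ← map_sum]
    rw [ih u (le_trans hu hs)]

theorem iterInt_eq_sum_antidiagonal (hε : 0 < ε) (hX : IsDecaying C ε X)
    (hY : IsDecaying C ε Y) (hH : IsDecaying C ε H) (hXY : ∀ u, X u - Y u = H u) (n : ℕ) :
    iterInt X Y n 0 = ∑ p ∈ Finset.HasAntidiagonal.antidiagonal n,
      iterInt H (fun _ => 0) p.1 0 * iterIntBot X Y p.2 := by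
  ext x
  rw [iterInt_apply_eq_sum_antidiagonal hε hX hY hH hXY n 0 le_rfl,
    sum_apply]
  rfl

end Operators

/-! ### The evolution operator -/

section Evolution

variable {ι E : Type*} [NormedAddCommGroup E] [InnerProductSpace ℂ E] [CompleteSpace E]
variable {Φ : HilbertBasis ι ℂ E} {en : ι → ℝ} {V : E →L[ℂ] E} {ε : ℝ}

theorem norm_freeExp_apply (Φ : HilbertBasis ι ℂ E) (en : ι → ℝ) (θ : ℝ) (x : E) :
    ‖freeExp Φ en θ x‖ = ‖x‖ :=
  (Φ.repr.trans (rotatedBasis Φ en θ).repr.symm).norm_map x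

theorem norm_freeExp_le (Φ : HilbertBasis ι ℂ E) (en : ι → ℝ) (θ : ℝ) :
    ‖freeExp Φ en θ‖ ≤ 1 :=
  ContinuousLinearMap.opNorm_le_bound _ zero_le_one fun x => by
    rw [norm_freeExp_apply, one_mul]

/-- The vectors with continuous orbit form a subspace, closed because the operators are isometries,
and it contains the eigenvectors. -/
theorem continuous_freeExp_apply (Φ : HilbertBasis ι ℂ E) (en : ι → ℝ) (x : E) :
    Continuous fun θ => freeExp Φ en θ x := by
  let S : Submodule ℂ E :=
    { carrier := {x | Continuous fun θ => freeExp Φ en θ x}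
      zero_mem' := by simpa using continuous_const
      add_mem' := fun hx hy => by
        simp only [Set.mem_ofPred_eq, map_add] at *
        exact hx.add hy
      smul_mem' := fun c x hx => by
        simp only [Set.mem_ofPred_eq, map_smul] at *
        exact hx.const_smul c }
  have hS : IsClosed (S : Set E) := by
    rw [← closure_subset_iff_isClosed]
    intro x hx
    refine continuous_of_uniform_approx_of_continuous fun u hu => ?_
    obtain ⟨δ, hδ, hu⟩ := Metric.mem_uniformity_dist.mp hu
    obtain ⟨y, hy, hxy⟩ := Metric.mem_closure_iff.mp hx δ hδ
    refine ⟨_, hy, fun θ => hu ?_⟩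
    rwa [dist_eq_norm, ← map_sub, norm_freeExp_apply, ← dist_eq_norm]
  have hspan : Submodule.span ℂ (Set.range Φ) ≤ S := by
    rw [Submodule.span_le]
    rintro _ ⟨i, rfl⟩
    change Continuous fun θ => freeExp Φ en θ (Φ i)
    simp only [freeExp_apply_basis]
    fun_prop
  have htop : (⊤ : Submodule ℂ E) ≤ S := by
    rw [← Φ.dense_span]
    exact Submodule.topologicalClosure_minimal _ hspan hS
  exact htop (Submodule.mem_top (x := x))

theorem continuous_freeExp_uncurry (Φ : HilbertBasis ι ℂ E) (en : ι → ℝ) :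
    Continuous fun p : ℝ × E => freeExp Φ en p.1 p.2 :=
  (show IsDecaying 1 0 (freeExp Φ en) from
    { continuous_apply := continuous_freeExp_apply Φ en
      norm_le := norm_freeExp_le Φ en
      norm_le_exp := fun t _ => by simpa using norm_freeExp_le Φ en t }).continuous_uncurry

theorem isDecaying_Hi (Φ : HilbertBasis ι ℂ E) (en : ι → ℝ) (V : E →L[ℂ] E) (hε : 0 < ε) :
    IsDecaying ‖V‖ ε (Hi Φ en V ε) := by
  have hle : ∀ t, ‖Hi Φ en V ε t‖ ≤ ‖V‖ * Real.exp (-ε * |t|) := by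
    intro t
    rw [Hi, norm_smul, interaction, norm_smul, norm_neg, Complex.norm_I, one_mul, Complex.norm_real,
      Real.norm_of_nonneg (Real.exp_pos _).le, mul_comm]
    gcongr
    calc _ ≤ ‖freeExp Φ en t‖ * ‖V‖ * ‖freeExp Φ en (-t)‖ :=
          (norm_mul_le _ _).trans (mul_le_mul_of_nonneg_right (norm_mul_le _ _) (norm_nonneg _))
      _ ≤ 1 * ‖V‖ * 1 := by
          gcongr
          exacts [norm_freeExp_le Φ en t, norm_freeExp_le Φ en (-t)]
      _ = ‖V‖ := by ring
  refine ⟨fun x => ?_, fun t => (hle t).trans (mul_le_of_le_one_right (norm_nonneg _) ?_),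
    fun t ht => (hle t).trans_eq ?_⟩
  · have h1 : Continuous fun t => freeExp Φ en (-t) x :=
      (continuous_freeExp_apply Φ en x).comp continuous_neg
    have h2 : Continuous fun t => freeExp Φ en t (V (freeExp Φ en (-t) x)) :=
      (continuous_freeExp_uncurry Φ en).comp (f := fun t => (t, V (freeExp Φ en (-t) x)))
        (continuous_id.prodMk (V.continuous.comp h1))
    have h3 : Continuous fun t : ℝ => ((Real.exp (-ε * |t|) : ℝ) : ℂ) :=
      Complex.continuous_ofReal.comp (by fun_prop)
    have h4 : ∀ t, Hi Φ en V ε t x = (-Complex.I) •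
        (((Real.exp (-ε * |t|) : ℝ) : ℂ) • freeExp Φ en t (V (freeExp Φ en (-t) x))) :=
      fun t => rfl
    simp only [h4]
    exact (h3.smul h2).const_smul (-Complex.I)
  · rw [Real.exp_le_one_iff]
    nlinarith [abs_nonneg t]
  · rw [abs_of_nonpos ht]
    congr 2
    ring

namespace IsEvolution

variable {U : ℝ → E →L[ℂ] E}

theorem hasDerivAt (hU : IsEvolution Φ en V ε U) (x : E) (t : ℝ) :
    HasDerivAt (fun s => U s x) (Hi Φ en V ε t (U t x)) t := by
  obtain ⟨d, hd, h⟩ := hU.schrodinger x t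
  have : d = Hi Φ en V ε t (U t x) := by
    rw [Hi, smul_apply, ← h, smul_smul]
    simp
  rwa [← this]

theorem continuous_apply (hU : IsEvolution Φ en V ε U) (x : E) : Continuous fun s => U s x :=
  continuous_iff_continuousAt.mpr fun t => (hU.hasDerivAt x t).continuousAt

/-- Near `-∞` the bound comes from the initial condition, on the remaining compact interval from
continuity. -/
theorem exists_norm_le (hU : IsEvolution Φ en V ε U) (x : E) : ∃ M, ∀ u ≤ 0, ‖U u x‖ ≤ M := by
  have h1 : ∀ᶠ t in atBot, ‖U t x‖ ≤ ‖x‖ + 1 :=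
    ((hU.initial x).norm.eventually_lt_const (lt_add_one _)).mono fun _ h => h.le
  obtain ⟨a, ha⟩ := eventually_atBot.mp h1
  obtain ⟨M, hM⟩ := (isCompact_Icc (a := a) (b := (0 : ℝ))).exists_bound_of_continuousOn
    (hU.continuous_apply x).continuousOn
  refine ⟨max (‖x‖ + 1) M, fun u hu => ?_⟩
  rcases le_total u a with h | h
  · exact (ha u h).trans (le_max_left _ _)
  · exact (hM u ⟨h, hu⟩).trans (le_max_right _ _)

theorem integral_eq (hU : IsEvolution Φ en V ε U) (hε : 0 < ε) (x : E) {s : ℝ} (hs : s ≤ 0) :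
    U s x = x + ∫ u in Set.Iic s, Hi Φ en V ε u (U u x) := by
  obtain ⟨M, hM⟩ := hU.exists_norm_le x
  rw [integral_Iic_of_hasDerivAt_of_tendsto (hU.continuous_apply x).continuousWithinAt
    (fun t _ => hU.hasDerivAt x t)
    ((integrableOn_apply hε (isDecaying_Hi Φ en V hε) (hU.continuous_apply x) hM).mono_set
      (Set.Iic_subset_Iic.mpr hs)) (hU.initial x)]
  abel

theorem hasSum_iterInt (hU : IsEvolution Φ en V ε U) (hε : 0 < ε) :
    HasSum (fun n => iterInt (Hi Φ en V ε) (fun _ => 0) n 0) (U 0) :=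
  hasSum_iterInt_of_integral_eq hε (isDecaying_Hi Φ en V hε) hU.continuous_apply
    (fun x _ hs => hU.integral_eq hε x hs) hU.exists_norm_le

end IsEvolution

end Evolution

section Operators

variable {E : Type*} [NormedAddCommGroup E] [InnerProductSpace ℂ E]
variable {C ε : ℝ} {H X Y : ℝ → E →L[ℂ] E}

/-! ### Ordered products of operators depending on several times -/

/-- Each factor is tested on all measurable vector-valued `F`, because inside the product it acts on
a vector that already depends on `a`. -/
theorem stronglyMeasurable_prod_ofFn_apply {α : Type*} [MeasurableSpace α] {n : ℕ}
    {f : Fin n → α → E →L[ℂ] E}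
    (hf : ∀ (i : Fin n) (F : α → E), StronglyMeasurable F → StronglyMeasurable fun a => f i a (F a))
    {F : α → E} (hF : StronglyMeasurable F) :
    StronglyMeasurable fun a => (List.ofFn fun i => f i a).prod (F a) := by
  induction n with
  | zero => simpa using hF
  | succ n ih =>
    simp only [List.ofFn_succ, List.prod_cons, mul_apply_eq_comp]
    exact hf 0 _ (ih fun i => hf i.succ)

theorem norm_prod_ofFn_le {n : ℕ} {f : Fin n → E →L[ℂ] E} {g : Fin n → ℝ}
    (h : ∀ i, ‖f i‖ ≤ g i) : ‖(List.ofFn f).prod‖ ≤ ∏ i, g i := by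
  induction n with
  | zero => simpa [ContinuousLinearMap.one_def] using
      (ContinuousLinearMap.norm_id_le : ‖ContinuousLinearMap.id ℂ E‖ ≤ 1)
  | succ n ih =>
    rw [List.ofFn_succ, List.prod_cons, Fin.prod_univ_succ]
    exact (norm_mul_le _ _).trans (mul_le_mul (h 0) (ih fun i => h i.succ) (norm_nonneg _)
      ((norm_nonneg _).trans (h 0)))

/-- The measure on `(-∞, 0]ⁿ`. -/
def orthant (n : ℕ) : Measure (Fin n → ℝ) :=
  Measure.pi fun _ => (volume : Measure ℝ).restrict (Set.Iic 0)

instance (n : ℕ) : SigmaFinite (orthant n) := by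
  unfold orthant
  infer_instance

theorem orthant_eq_restrict (n : ℕ) :
    orthant n = volume.restrict (Set.univ.pi fun _ => Set.Iic 0) :=
  (Measure.restrict_pi_pi _ _).symm

theorem ae_orthant_nonpos (n : ℕ) : ∀ᵐ t ∂orthant n, ∀ i, t i ≤ 0 := by
  rw [orthant_eq_restrict]
  exact (ae_restrict_mem (MeasurableSet.univ_pi fun _ => measurableSet_Iic)).mono
    fun t ht i => ht i (Set.mem_univ i)

/-- Coinciding times lie in finitely many proper subspaces `t i = t j`, which are null. Ties between
overlapping simplices can thus be ignored. -/
theorem ae_orthant_injective (n : ℕ) : ∀ᵐ t ∂orthant n, Function.Injective t := by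
  have h : ∀ i j : Fin n, i ≠ j → ∀ᵐ t : Fin n → ℝ, t i ≠ t j := by
    intro i j hij
    let S : Submodule ℝ (Fin n → ℝ) := LinearMap.ker
      ((LinearMap.proj i : (Fin n → ℝ) →ₗ[ℝ] ℝ) - LinearMap.proj j)
    have hS : S ≠ ⊤ := by
      intro htop
      have : (Pi.single i 1 : Fin n → ℝ) ∈ S := htop ▸ Submodule.mem_top
      simp [S, hij.symm] at this
    rw [ae_iff]
    convert Measure.addHaar_submodule volume S hS using 2
    ext t
    simp [S, sub_eq_zero]
  rw [orthant_eq_restrict]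
  refine ae_restrict_of_ae ?_
  have h' : ∀ᵐ t : Fin n → ℝ, ∀ i j, i ≠ j → t i ≠ t j := by
    simp only [ae_all_iff]
    exact h
  exact h'.mono fun t ht i j hij => by_contra fun hne => ht i j hne hij

theorem isStrongIntegral_prod_ofFn (hε : 0 < ε) {n : ℕ} {f : Fin n → (Fin n → ℝ) → E →L[ℂ] E}
    (hf : ∀ (i : Fin n) (F : (Fin n → ℝ) → E), StronglyMeasurable F →
      StronglyMeasurable fun t => f i t (F t))
    (hle : ∀ i t, t i ≤ 0 → ‖f i t‖ ≤ C * Real.exp (ε * t i)) :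
    IsStrongIntegral (orthant n) (fun t => (List.ofFn fun i => f i t).prod)
      (strongIntegral (orthant n) fun t => (List.ofFn fun i => f i t).prod) :=
  isStrongIntegral_strongIntegral
    (fun _ => (stronglyMeasurable_prod_ofFn_apply hf stronglyMeasurable_const).aestronglyMeasurable)
    (Integrable.fintype_prod fun _ => integrableOn_const_mul_exp hε C 0)
    ((ae_orthant_nonpos n).mono fun t ht => norm_prod_ofFn_le fun i => hle i t (ht i))

/-- The product `k(s, t₁) k(t₁, t₂) ⋯ k(tₙ₋₁, tₙ)`. -/
def kernelProd (X Y : ℝ → E →L[ℂ] E) (n : ℕ) (s : ℝ) (t : Fin n → ℝ) : E →L[ℂ] E :=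
  (List.ofFn fun i => kernel X Y ((Fin.cons s t : Fin (n + 1) → ℝ) i.castSucc) (t i)).prod

theorem kernelProd_succ (X Y : ℝ → E →L[ℂ] E) (n : ℕ) (s : ℝ) (t : Fin (n + 1) → ℝ) :
    kernelProd X Y (n + 1) s t = kernel X Y s (t 0) * kernelProd X Y n (t 0) (Fin.tail t) := by
  simp only [kernelProd, List.ofFn_succ, List.prod_cons, Fin.cons_self_tail]
  rfl

theorem stronglyMeasurable_kernelProd_apply {α : Type*} [MeasurableSpace α]
    (hX : IsDecaying C ε X) (hY : IsDecaying C ε Y) (n : ℕ) {s : α → ℝ} {t : α → Fin n → ℝ}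
    (hs : Measurable s) (ht : Measurable t) (x : E) :
    StronglyMeasurable fun a => kernelProd X Y n (s a) (t a) x := by
  refine stronglyMeasurable_prod_ofFn_apply (fun i F hF => stronglyMeasurable_kernel_apply hX hY
    ?_ ((measurable_pi_apply i).comp ht) hF) stronglyMeasurable_const
  refine Fin.cases ?_ (fun j => ?_) i.castSucc
  · simpa using hs
  · simp only [Fin.cons_succ]
    exact (measurable_pi_apply j).comp ht

/-- Fubini, splitting off the first time; the remaining product is the same kernel product with base
point `t 0`. -/
theorem isStrongIntegral_kernelProd [CompleteSpace E] (hε : 0 < ε) (hX : IsDecaying C ε X)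
    (hY : IsDecaying C ε Y) (n : ℕ) (s : ℝ) :
    IsStrongIntegral (orthant n) (kernelProd X Y n s) (iterInt X Y n s) := by
  have hint : ∀ n s x, Integrable (fun t => kernelProd X Y n s t x) (orthant n) := by
    intro n s x
    have hC := hX.const_nonneg
    refine ((Integrable.fintype_prod fun _ : Fin n =>
      integrableOn_const_mul_exp hε C 0).mul_const ‖x‖).mono'
      (stronglyMeasurable_kernelProd_apply hX hY n measurable_const measurable_id
        x).aestronglyMeasurable ((ae_orthant_nonpos n).mono fun t ht => ?_)
    exact (kernelProd X Y n s t).le_of_opNorm_le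
      (norm_prod_ofFn_le fun i => norm_kernel_le_exp hX hY _ (ht i)) x
  intro x
  refine ⟨hint n s x, ?_⟩
  induction n generalizing s with
  | zero => simp [orthant, iterInt, kernelProd, measureReal_def]
  | succ n ih =>
    have mp := measurePreserving_piFinSuccAbove (n := n)
      (fun _ => (volume : Measure ℝ).restrict (Set.Iic 0)) 0
    let g : ℝ × (Fin n → ℝ) → E := fun p => kernel X Y s p.1 (kernelProd X Y n p.1 p.2 x)
    have hg : ∀ t, kernelProd X Y (n + 1) s t x =
        g (MeasurableEquiv.piFinSuccAbove (fun _ => ℝ) 0 t) := by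
      intro t
      rw [kernelProd_succ]
      rfl
    have hgi : Integrable g (((volume : Measure ℝ).restrict (Set.Iic 0)).prod (orthant n)) := by
      refine (mp.integrable_comp_emb (MeasurableEquiv.measurableEmbedding _)).mp ?_
      exact (hint (n + 1) s x).congr (Eventually.of_forall hg)
    rw [(isStrongIntegral_iterInt_succ hε hX hY n s x).2]
    simp only [hg]
    refine Eq.trans ?_ (mp.integral_comp' g).symm
    refine Eq.trans ?_ (integral_prod g hgi).symm
    congr 1
    funext u
    rw [mul_apply_eq_comp, ih u]
    exact ((kernel X Y s u).integral_comp_comm (hint n u x)).symm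

/-! ### Integrals over the simplex -/

/-- Prepending the time `0` absorbs the condition `t i ≤ 0`, so the simplex is described by the same
consecutive comparisons as the kernel product. -/
theorem mem_simplex_iff {n : ℕ} {t : Fin n → ℝ} :
    t ∈ simplex n ↔ Antitone (Fin.cons 0 t : Fin (n + 1) → ℝ) := by
  constructor
  · rintro ⟨h1, h2⟩
    rw [Fin.antitone_iff_succ_le]
    intro i
    rw [Fin.cons_succ]
    cases n with
    | zero => exact i.elim0
    | succ n =>
      refine Fin.cases ?_ (fun j => ?_) i
      · simpa using h2 0
      · rw [← Fin.succ_castSucc, Fin.cons_succ]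
        exact h1 (Fin.castSucc_lt_succ).le
  · intro h
    refine ⟨fun i j hij => ?_, fun i => ?_⟩
    · simpa using h (Fin.succ_le_succ_iff.mpr hij)
    · simpa using h (Fin.zero_le i.succ)

theorem measurableSet_simplex (n : ℕ) : MeasurableSet (simplex n) := by
  have h : IsClosed (simplex n) := by
    have : simplex n = {t | Antitone t} ∩ ⋂ i, {t | t i ≤ 0} := by
      ext t
      simp [simplex]
    rw [this]
    exact isClosed_antitone.inter
      (isClosed_iInter fun i => isClosed_le (continuous_apply i) continuous_const)
  exact h.measurableSet

theorem restrict_simplex_eq (n : ℕ) :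
    (volume : Measure (Fin n → ℝ)).restrict (simplex n) = (orthant n).restrict (simplex n) := by
  rw [orthant_eq_restrict, Measure.restrict_restrict (measurableSet_simplex n),
    Set.inter_eq_left.mpr fun t ht i _ => ht.2 i]

-- With second branch `0`, a single pair of consecutive times out of order annihilates the product;
-- what is left is the Picard integrand.
open Classical in
theorem kernelProd_zero_right (H : ℝ → E →L[ℂ] E) (n : ℕ) (t : Fin n → ℝ) :
    kernelProd H (fun _ => 0) n 0 t =
      if t ∈ simplex n then (List.ofFn fun i => H (t i)).prod else 0 := by
  rw [mem_simplex_iff, Fin.antitone_iff_succ_le]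
  simp only [Fin.cons_succ]
  split_ifs with h
  · simp only [kernelProd, kernel, h, if_true]
  · obtain ⟨i, hi⟩ := not_forall.mp h
    refine List.prod_eq_zero (List.mem_ofFn.mpr ⟨i, ?_⟩)
    rw [kernel, if_neg hi]

open Classical in
theorem isStrongIntegral_restrict_simplex_iff {n : ℕ} {f : (Fin n → ℝ) → E →L[ℂ] E}
    {S : E →L[ℂ] E} : IsStrongIntegral (volume.restrict (simplex n)) f S ↔
      IsStrongIntegral (orthant n) (fun t => if t ∈ simplex n then f t else 0) S := by
  have h : ∀ x, (fun t => (if t ∈ simplex n then f t else 0) x) =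
      (simplex n).indicator fun t => f t x := by
    intro x
    funext t
    by_cases ht : t ∈ simplex n <;> simp [ht]
  simp only [IsStrongIntegral, h, restrict_simplex_eq,
    integrable_indicator_iff (measurableSet_simplex n), IntegrableOn,
    integral_indicator (measurableSet_simplex n)]

theorem picardTerm_eq_iterInt [CompleteSpace E] (hε : 0 < ε) (hH : IsDecaying C ε H) (n : ℕ) :
    picardTerm H n = iterInt H (fun _ => 0) n 0 := by
  classical
  refine IsStrongIntegral.strongIntegral_eq (isStrongIntegral_restrict_simplex_iff.mpr ?_)
  have h := isStrongIntegral_kernelProd hε hH (isDecaying_zero hH.const_nonneg) n 0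
  convert h using 1
  funext t
  rw [kernelProd_zero_right]

end Operators

section Operators

variable {E : Type*} [NormedAddCommGroup E] [InnerProductSpace ℂ E]
variable {C ε : ℝ} {A B H : ℝ → E →L[ℂ] E}

/-! ### Iterated integrals of signed permutations -/

/-- The ordered product of the values of `B` and `A`, according to the bars. -/
def barProd (A B : ℝ → E →L[ℂ] E) {n : ℕ} (b : Fin n → Bool) (t : Fin n → ℝ) : E →L[ℂ] E :=
  (List.ofFn fun i => (if b i then B else A) (t i)).prod

open Classical in
/-- After reordering the times, `⟨s⟩` is an integral over the part of the orthant in which the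
times are ordered as prescribed by `s`. -/
theorem isStrongIntegral_bracket [CompleteSpace E] (hε : 0 < ε) (hA : IsDecaying C ε A)
    (hB : IsDecaying C ε B) {n : ℕ} (s : SignedPerm n) :
    IsStrongIntegral (orthant n)
      (fun t => if t ∘ s.perm.symm ∈ simplex n then barProd A B s.bar t else 0)
      (bracket A B s) := by
  have hAB : ∀ i, IsDecaying C ε (if s.bar i then B else A) := by
    intro i
    split_ifs
    exacts [hB, hA]
  have mp := measurePreserving_piCongrLeft (α := fun _ => ℝ)
    (fun _ : Fin n => (volume : Measure ℝ).restrict (Set.Iic 0)) s.perm.symm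
  have hcongr : ∀ t : Fin n → ℝ,
      MeasurableEquiv.piCongrLeft (fun _ => ℝ) s.perm.symm t = t ∘ s.perm := by
    intro t
    funext i
    have h := MeasurableEquiv.piCongrLeft_apply_apply (β := fun _ => ℝ) s.perm.symm t (s.perm i)
    simpa using h
  let g : E → (Fin n → ℝ) → E := fun x t =>
    (if t ∘ s.perm.symm ∈ simplex n then barProd A B s.bar t else 0) x
  have hmeas : MeasurableSet {t : Fin n → ℝ | t ∘ s.perm.symm ∈ simplex n} :=
    (measurableSet_simplex n).preimage
      (measurable_pi_lambda _ fun i => measurable_pi_apply (s.perm.symm i))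
  have hg : ∀ x, Integrable (g x) (orthant n) := by
    intro x
    have h := (isStrongIntegral_prod_ofFn hε
      (f := fun i t => (if s.bar i then B else A) (t i))
      (fun i F hF => (hAB i).continuous_uncurry.comp_stronglyMeasurable
        ((measurable_pi_apply i).stronglyMeasurable.prodMk hF))
      (fun i t ht => (hAB i).norm_le_exp _ ht) x).1
    refine (h.indicator hmeas).congr (Eventually.of_forall fun t => ?_)
    by_cases ht : t ∘ s.perm.symm ∈ simplex n
    · simp [g, ht, barProd]
    · simp [g, ht]
  have hsymm : ∀ t : Fin n → ℝ, (t ∘ s.perm) ∘ s.perm.symm = t := by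
    intro t
    funext i
    simp
  -- Existence has to be established separately, since `bracket` defaults to `0` when there is no
  -- strong integral.
  have key : ∃ S, IsStrongIntegral (orthant n)
      (fun t => if t ∘ s.perm.symm ∈ simplex n then barProd A B s.bar t else 0) S := by
    refine ⟨_, isStrongIntegral_strongIntegral (g := fun t => ∏ i, C * Real.exp (ε * t i))
      (fun x => (hg x).1) (Integrable.fintype_prod fun _ => integrableOn_const_mul_exp hε C 0)
      ((ae_orthant_nonpos n).mono fun t ht => ?_)⟩
    have hC := hA.const_nonneg
    split_ifs
    · exact norm_prod_ofFn_le fun i => (hAB i).norm_le_exp _ (ht i)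
    · rw [norm_zero]
      exact Finset.prod_nonneg fun i _ => by positivity
  obtain ⟨S, hS⟩ := key
  have hbr : bracket A B s = S := by
    refine IsStrongIntegral.strongIntegral_eq (isStrongIntegral_restrict_simplex_iff.mpr ?_)
    intro x
    have hfun : (fun t => (if t ∈ simplex n then
        (List.ofFn fun i => (if s.bar i then B else A) (t (s.perm i))).prod else 0) x) =
        fun t => g x (MeasurableEquiv.piCongrLeft (fun _ => ℝ) s.perm.symm t) := by
      funext t
      simp only [g, hcongr, hsymm]
      rfl
    rw [hfun]
    exact ⟨(mp.integrable_comp_emb (MeasurableEquiv.measurableEmbedding _)).mpr (hg x),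
      (hS x).2.trans (mp.integral_comp' (g x)).symm⟩
  rw [hbr]
  exact hS

/-! ### Signed permutations without regression -/

theorem SignedPerm.reg_eq_empty_iff {n : ℕ} (s : SignedPerm (n + 1)) :
    s.reg = ∅ ↔ ∀ i : Fin n, s.Progression i.castSucc i.succ := by
  constructor
  · intro h i
    by_contra hi
    have : (i : ℕ) + 1 ∈ s.reg := ⟨i.castSucc, i.succ, rfl, by simp, hi⟩
    simp [h] at this
  · intro h
    rw [Set.eq_empty_iff_forall_notMem]
    rintro k ⟨i, j, hi, hj, hij⟩
    have hin : (i : ℕ) < n := by have := j.2; omega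
    refine hij ?_
    convert h ⟨i, hin⟩ using 1
    · rfl
    · exact Fin.ext (by simp only [Fin.val_succ]; omega)

/-- The bars of the signed permutation without regression that orders the times `t`, where the
first entry is compared with the time `0`. -/
def progressionBar {n : ℕ} (t : Fin n → ℝ) (i : Fin n) : Bool :=
  decide (¬ t i ≤ (Fin.cons 0 t : Fin (n + 1) → ℝ) i.castSucc)

theorem kernelProd_eq_barProd (A B : ℝ → E →L[ℂ] E) {n : ℕ} (t : Fin n → ℝ) :
    kernelProd A B n 0 t = barProd A B (progressionBar t) t := by
  unfold kernelProd barProd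
  congr 2
  funext i
  by_cases h : t i ≤ (Fin.cons 0 t : Fin (n + 1) → ℝ) i.castSucc <;>
    simp [kernel, progressionBar, h]

/-- Times decrease with their index on the simplex, so an increasing step of the permutation is a
step to an earlier time. A progression thus fixes the bar exactly as the kernel chooses between `A`
and `B`. -/
theorem SignedPerm.bar_succ_eq_of_progression {n : ℕ} {s : SignedPerm (n + 1)}
    {t : Fin (n + 1) → ℝ} (ht : StrictAnti (t ∘ s.perm.symm)) (i : Fin n) :
    s.Progression i.castSucc i.succ ↔ s.bar i.succ = progressionBar t i.succ := by
  have hlt : ∀ i j, s.perm i < s.perm j ↔ t j < t i := by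
    intro i j
    simpa using (ht.lt_iff_gt (a := s.perm j) (b := s.perm i)).symm
  have hne : t i.castSucc ≠ t i.succ := by
    intro h
    have h1 : s.perm i.castSucc = s.perm i.succ := ht.injective (by simpa using h)
    exact absurd (s.perm.injective h1) (Fin.castSucc_lt_succ).ne
  have hc : (Fin.cons 0 t : Fin (n + 2) → ℝ) i.succ.castSucc = t i.castSucc := by
    rw [← Fin.succ_castSucc, Fin.cons_succ]
  rw [SignedPerm.Progression, hlt, hlt, progressionBar, hc]
  rcases lt_or_gt_of_ne hne with h | h
  · simp [h, h.not_gt]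
  · simp [h, h.not_gt, h.le]

open Classical in
/-- For distinct times, exactly one signed permutation without regression whose first entry is not
barred orders them. -/
theorem mul_sum_barProd_eq {n : ℕ} {Q : E →L[ℂ] E} (hA : ∀ u, Q * A u = A u)
    (hB : ∀ u, Q * B u = 0) {t : Fin (n + 1) → ℝ} (ht : Function.Injective t)
    (ht0 : ∀ i, t i ≤ 0) :
    Q * ∑ s : SignedPerm (n + 1) with s.reg = ∅,
      (if t ∘ s.perm.symm ∈ simplex (n + 1) then barProd A B s.bar t else 0) =
      kernelProd A B (n + 1) 0 t := by
  -- Sorting `-t` increasingly puts `t` in decreasing order.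
  obtain ⟨τ, hτ⟩ : ∃ τ : Equiv.Perm (Fin (n + 1)), Antitone (t ∘ τ) :=
    ⟨Tuple.sort fun i => -t i, fun i j hij => neg_le_neg_iff.mp
      (Tuple.monotone_sort (fun i => -t i) hij)⟩
  have huniq : ∀ σ : Equiv.Perm (Fin (n + 1)), Antitone (t ∘ σ) → σ = τ := by
    intro σ hσ
    have h := Tuple.unique_monotone (f := fun i => -t i) (σ := σ) (τ := τ)
      (fun i j hij => neg_le_neg (hσ hij)) (fun i j hij => neg_le_neg (hτ hij))
    ext1 i
    exact ht (neg_injective (congrFun h i))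
  have hbar0 : progressionBar t 0 = false := by
    simp [progressionBar, ht0]
  let s₀ : SignedPerm (n + 1) := ⟨τ.symm, progressionBar t⟩
  have hanti : ∀ s : SignedPerm (n + 1), s.perm.symm = τ → StrictAnti (t ∘ s.perm.symm) :=
    fun s hs => by
      rw [hs]
      exact hτ.strictAnti_of_injective (ht.comp τ.injective)
  have hs₀ : s₀.reg = ∅ := (SignedPerm.reg_eq_empty_iff s₀).mpr fun i =>
    (SignedPerm.bar_succ_eq_of_progression (hanti s₀ rfl) i).mpr rfl
  have hmem : t ∘ s₀.perm.symm ∈ simplex (n + 1) := ⟨hτ, fun i => ht0 _⟩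
  have hval : ∀ b : Fin (n + 1) → Bool,
      Q * barProd A B b t = if b 0 then 0 else barProd A B b t := by
    intro b
    rw [barProd, List.ofFn_succ, List.prod_cons, ← mul_assoc]
    split_ifs with h
    · simp [hB]
    · simp [hA]
  rw [Finset.mul_sum, Finset.sum_eq_single s₀]
  · rw [if_pos hmem, hval, kernelProd_eq_barProd]
    simp [s₀, hbar0]
  · intro s hs hne
    split_ifs with h
    · have hperm := huniq _ h.1
      -- Another signed permutation with the same ordering can differ from `s₀` only in the first
      -- bar; it then starts with `B` and is killed by `Q`.
      rw [hval, if_pos]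
      by_contra hb
      refine hne (SignedPerm.ext ?_ ?_)
      · change s.perm = τ.symm
        rw [← hperm, Equiv.symm_symm]
      · funext i
        refine Fin.cases ?_ (fun j => ?_) i
        · simpa [s₀, hbar0] using hb
        · exact (SignedPerm.bar_succ_eq_of_progression (hanti s hperm) j).mp
            ((SignedPerm.reg_eq_empty_iff s).mp (Finset.mem_filter.mp hs).2 j)
    · rw [mul_zero]
  · intro h
    exact absurd (by simpa using hs₀) h

open Classical in
theorem bracketLin_regressionSum (A B : ℝ → E →L[ℂ] E) (n : ℕ) :
    bracketLin A B (regressionSum n ∅) =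
      ∑ s : SignedPerm n with s.reg = ∅, bracket A B s := by
  rw [bracketLin, regressionSum, ← Finsupp.sum_finsetSum_index]
  · simp
  · simp
  · intro s c d
    push_cast
    rw [add_smul]

theorem mul_bracketLin_regressionSum_eq [CompleteSpace E] (hε : 0 < ε) (hA : IsDecaying C ε A)
    (hB : IsDecaying C ε B) {Q : E →L[ℂ] E} (hQA : ∀ u, Q * A u = A u)
    (hQB : ∀ u, Q * B u = 0) (n : ℕ) :
    Q * bracketLin A B (regressionSum (n + 1) ∅) = iterInt A B (n + 1) 0 := by
  classical
  rw [bracketLin_regressionSum]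
  ext x
  have hbr := fun s : SignedPerm (n + 1) => isStrongIntegral_bracket hε hA hB s
  rw [(isStrongIntegral_kernelProd hε hA hB (n + 1) 0 x).2, mul_apply_eq_comp, sum_apply]
  simp only [fun s => (hbr s x).2]
  rw [← integral_finsetSum _ fun s _ => (hbr s x).1,
    ← Q.integral_comp_comm (integrable_finsetSum _ fun s _ => (hbr s x).1)]
  refine integral_congr_ae ?_
  filter_upwards [ae_orthant_injective (n + 1), ae_orthant_nonpos (n + 1)] with t ht ht0
  rw [← mul_sum_barProd_eq hQA hQB ht ht0, mul_apply_eq_comp, sum_apply]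

end Operators

/-! ### Formal series and inverses on the image of a projection -/

section Formal

variable {R : Type*} [Ring R]

/-- Multiplication by `f` raises the order, so the coefficients of `e` vanish by strong induction.
-/
theorem powerSeries_eq_zero_of_eq_mul {f e : PowerSeries R}
    (hf : PowerSeries.constantCoeff f = 0) (h : e = f * e) : e = 0 := by
  ext n
  rw [map_zero]
  induction n using Nat.strong_induction_on with
  | _ n ih =>
    rw [h, PowerSeries.coeff_mul]
    refine Finset.sum_eq_zero fun p hp => ?_
    have hp' := Finset.HasAntidiagonal.mem_antidiagonal.mp hp
    rcases Nat.eq_zero_or_pos p.1 with h0 | h0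
    · rw [h0, PowerSeries.coeff_zero_eq_constantCoeff_apply, hf, zero_mul]
    · rw [ih p.2 (by omega), mul_zero]

/-- If `u z = g` where `p g = p` and `z p = p z p`, then `p z p` inverts `p u p` within the image
of `p`, provided that the constant coefficient of `u` is `1`. -/
theorem isInverseOn_of_mul_eq {p : R} (hp : p * p = p) {u z g : PowerSeries R}
    (hu : PowerSeries.constantCoeff u = 1) (huz : u * z = g)
    (hg : PowerSeries.C p * g = PowerSeries.C p)
    (hz : PowerSeries.C p * z * PowerSeries.C p = z * PowerSeries.C p) :
    IsInverseOn (PowerSeries.C p) (PowerSeries.C p * u * PowerSeries.C p)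
      (z * PowerSeries.C p) := by
  set q := PowerSeries.C p with hq
  have hqq : q * q = q := by rw [hq, ← map_mul, hp]
  have h1 : q * (z * q) = z * q := by rw [← mul_assoc, hz]
  have hright : q * u * q * (z * q) = q := by
    rw [mul_assoc (q * u), h1, mul_assoc q u, ← mul_assoc u, huz, ← mul_assoc, hg, hqq]
  refine ⟨?_, ?_, hright⟩
  · rw [h1, mul_assoc, hqq]
  -- A right inverse is also a left inverse here: the defect `e` satisfies `q e = e` and `(q u q) e
  -- = 0`, so `e = (q - q u q) e`, and `q - q u q` has constant coefficient `p - p p = 0`.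
  · have he : z * q * (q * u * q) - q = 0 := by
      set e := z * q * (q * u * q) - q with he
      have hqe : q * e = e := by
        rw [he, mul_sub, ← mul_assoc q, h1, hqq]
      have hte : q * u * q * e = 0 := by
        rw [he, mul_sub, ← mul_assoc, hright, mul_assoc (q * u) q q, hqq, ← mul_assoc,
          ← mul_assoc, hqq, sub_self]
      refine powerSeries_eq_zero_of_eq_mul (f := q - q * u * q) ?_ ?_
      · simp [hq, hu, hp]
      · rw [sub_mul, hte, hqe, sub_zero]
    exact sub_eq_zero.mp he

theorem gellMannLow_eq_of_isInverseOn {p u w : R} (hp : p * p = p)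
    (h : IsInverseOn p (p * u * p) w) : gellMannLow p u = u * p * w := by
  rw [gellMannLow, ← h.eq_inverseOn hp]

end Formal

/-! ### Cauchy products of a strongly convergent and an absolutely convergent series -/

section Operators

variable {ι E : Type*} [NormedAddCommGroup E] [InnerProductSpace ℂ E] [CompleteSpace E]

/-- A Mertens theorem for strong convergence. Banach–Steinhaus bounds the partial sums of `a`
uniformly; this bound and the summability of `‖c n‖` allow dominated convergence. -/
theorem hasSum_mul_of_strongSum {a c : ℕ → E →L[ℂ] E} {S T : E →L[ℂ] E} (ha : StrongSum a S)
    (hc : Summable fun n => ‖c n‖) (hT : HasSum c T) (x : E) :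
    Tendsto (fun N => ∑ n ∈ Finset.range N,
      (∑ q ∈ Finset.HasAntidiagonal.antidiagonal n, a q.1 * c q.2) x) atTop
      (𝓝 ((S * T) x)) := by
  obtain ⟨M, hM⟩ := banach_steinhaus (g := fun N => ∑ n ∈ Finset.range N, a n) fun x => by
    obtain ⟨M, hM⟩ := (ha x).norm.bddAbove_range
    exact ⟨M, fun N => by simpa using hM ⟨N, rfl⟩⟩
  -- Summing the triangle along fixed `m` leaves the `(N - m)`-th partial sum of `a` applied to `c m
  -- x`.
  have hre : ∀ N, ∑ n ∈ Finset.range N,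
      (∑ q ∈ Finset.HasAntidiagonal.antidiagonal n, a q.1 * c q.2) x =
      ∑' m, if m < N then (∑ k ∈ Finset.range (N - m), a k) (c m x) else 0 := by
    intro N
    have h1 : ∀ n, (∑ q ∈ Finset.HasAntidiagonal.antidiagonal n, a q.1 * c q.2) x =
        ∑ m ∈ Finset.range (n + 1), a (n - m) (c m x) := by
      intro n
      rw [sum_apply, ← Finset.Nat.sum_antidiagonal_swap,
        Finset.Nat.sum_antidiagonal_eq_sum_range_succ_mk]
      rfl
    simp only [h1]
    rw [Finset.sum_range_diag_flip N fun m k => a k (c m x),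
      tsum_eq_sum (s := Finset.range N) fun m hm => if_neg (by simpa using hm)]
    refine Finset.sum_congr rfl fun m hm => ?_
    rw [if_pos (Finset.mem_range.mp hm), sum_apply]
  have hlim : (S * T) x = ∑' m, S (c m x) := by
    have h2 := ((S.comp (ContinuousLinearMap.apply ℂ E x : _ →L[ℂ] E)).hasSum hT).tsum_eq
    exact h2.symm
  simp only [hre]
  rw [hlim]
  have hM0 : 0 ≤ M := (norm_nonneg _).trans (hM 0)
  refine tendsto_tsum_of_dominated_convergence (bound := fun m => M * (‖c m‖ * ‖x‖))
    ((hc.mul_right _).mul_left _) (fun m => ?_) (Eventually.of_forall fun N m => ?_)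
  · have h3 : Tendsto (fun N => (∑ k ∈ Finset.range (N - m), a k) (c m x)) atTop
        (𝓝 (S (c m x))) := by
      simp only [sum_apply]
      exact (ha (c m x)).comp (tendsto_sub_atTop_nat m)
    refine h3.congr' ?_
    filter_upwards [eventually_gt_atTop m] with N hN
    rw [if_pos hN]
  · split_ifs
    · exact (ContinuousLinearMap.le_of_opNorm_le _ (hM (N - m)) _).trans
        (mul_le_mul_of_nonneg_left ((c m).le_opNorm x) hM0)
    · rw [norm_zero]
      positivity

/-- If the coefficients of `u` factor as a Cauchy product, then so does its sum. -/
theorem eq_mul_of_coeff_eq {a c u : ℕ → E →L[ℂ] E} {S T W : E →L[ℂ] E} (ha : StrongSum a S)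
    (hc : Summable fun n => ‖c n‖) (hT : HasSum c T) (hu : HasSum u W)
    (h : ∀ n, u n = ∑ q ∈ Finset.HasAntidiagonal.antidiagonal n, a q.1 * c q.2) :
    W = S * T := by
  ext x
  refine tendsto_nhds_unique ?_ (hasSum_mul_of_strongSum ha hc hT x)
  simp only [← h]
  exact ((ContinuousLinearMap.apply ℂ E x).hasSum hu).tendsto_sum_nat

/-! ### The hyperoctahedral expansion -/

variable {C ε : ℝ} {H : ℝ → E →L[ℂ] E} {P : E →L[ℂ] E}

theorem mul_regBracket_succ_eq (hε : 0 < ε) (hH : IsDecaying C ε H) (hPP : P * P = P)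
    (hP : ‖P‖ ≤ 1) (hP' : ‖1 - P‖ ≤ 1) (n : ℕ) :
    (1 - P) * regBracket P H (n + 1) =
      iterInt (fun t => (1 - P) * H t) (fun t => -(P * H t)) (n + 1) 0 :=
  mul_bracketLin_regressionSum_eq hε (hH.mul_left hP') (hH.mul_left hP).neg
    (fun u => by rw [← mul_assoc, sub_mul, one_mul, mul_sub, mul_one, hPP, sub_self, sub_zero])
    (fun u => by rw [mul_neg, ← mul_assoc, sub_mul, one_mul, hPP, sub_self, zero_mul, neg_zero]) n

/-- The formal series of the limits at `-∞`. -/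
def formalBot (P : E →L[ℂ] E) (H : ℝ → E →L[ℂ] E) : PowerSeries (E →L[ℂ] E) :=
  PowerSeries.mk (iterIntBot (fun t => (1 - P) * H t) fun t => -(P * H t))

theorem formalPicard_mul_formalBot (hε : 0 < ε) (hH : IsDecaying C ε H) (hPP : P * P = P)
    (hP : ‖P‖ ≤ 1) (hP' : ‖1 - P‖ ≤ 1) :
    formalPicard H * formalBot P H = 1 + (1 - PowerSeries.C P) * formalReg P H := by
  have hQ : (1 : PowerSeries (E →L[ℂ] E)) - PowerSeries.C P = PowerSeries.C (1 - P) := by simp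
  ext1 n
  rw [hQ, map_add, PowerSeries.coeff_C_mul, PowerSeries.coeff_mul]
  simp only [formalPicard, formalBot, formalReg, PowerSeries.coeff_mk,
    picardTerm_eq_iterInt hε hH]
  rw [← iterInt_eq_sum_antidiagonal hε (hH.mul_left hP') (hH.mul_left hP).neg hH
    fun u => by rw [sub_neg_eq_add, ← add_mul, sub_add_cancel, one_mul]]
  cases n with
  | zero => simp [iterInt]
  | succ n =>
    rw [if_neg n.succ_ne_zero, mul_regBracket_succ_eq hε hH hPP hP hP', PowerSeries.coeff_one,
      if_neg n.succ_ne_zero, zero_add]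

/-- The constant coefficient is `1`, and every later one is an integral of operators starting with
`-P H`, hence is fixed by `P` on the left. -/
theorem C_mul_formalBot_mul_C (hε : 0 < ε) (hH : IsDecaying C ε H) (hPP : P * P = P)
    (hP : ‖P‖ ≤ 1) (hP' : ‖1 - P‖ ≤ 1) :
    PowerSeries.C P * formalBot P H * PowerSeries.C P = formalBot P H * PowerSeries.C P := by
  ext1 n
  rw [PowerSeries.coeff_mul_C, PowerSeries.coeff_mul_C, PowerSeries.coeff_C_mul]
  simp only [formalBot, PowerSeries.coeff_mk]
  cases n with
  | zero => simp [iterIntBot, hPP]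
  | succ n =>
    have h := isStrongIntegral_iterIntBot_succ hε (hH.mul_left hP') (hH.mul_left hP).neg n
    congr 1
    ext x
    rw [mul_apply_eq_comp, (h x).2, ← P.integral_comp_comm (h x).1]
    congr 1
    funext u
    rw [← mul_apply_eq_comp, ← mul_assoc, mul_neg, ← mul_assoc, hPP]

theorem isInverseOn_formalPicard (hε : 0 < ε) (hH : IsDecaying C ε H) (hPP : P * P = P)
    (hP : ‖P‖ ≤ 1) (hP' : ‖1 - P‖ ≤ 1) :
    IsInverseOn (PowerSeries.C P) (PowerSeries.C P * formalPicard H * PowerSeries.C P)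
      (formalBot P H * PowerSeries.C P) := by
  refine isInverseOn_of_mul_eq hPP ?_ (formalPicard_mul_formalBot hε hH hPP hP hP') ?_
    (C_mul_formalBot_mul_C hε hH hPP hP hP')
  · rw [← PowerSeries.coeff_zero_eq_constantCoeff_apply]
    simp [formalPicard, picardTerm_eq_iterInt hε hH, iterInt]
  · rw [mul_add, mul_one, ← mul_assoc, mul_sub, mul_one, ← map_mul, hPP, sub_self, zero_mul,
      add_zero]

theorem formalPicard_mul_C_mul_inverse (hε : 0 < ε) (hH : IsDecaying C ε H) (hPP : P * P = P)
    (hP : ‖P‖ ≤ 1) (hP' : ‖1 - P‖ ≤ 1) :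
    formalPicard H * PowerSeries.C P * (formalBot P H * PowerSeries.C P) =
      PowerSeries.C P + (1 - PowerSeries.C P) * formalReg P H * PowerSeries.C P := by
  rw [mul_assoc, ← mul_assoc (PowerSeries.C P), C_mul_formalBot_mul_C hε hH hPP hP hP',
    ← mul_assoc, formalPicard_mul_formalBot hε hH hPP hP hP', add_mul, one_mul]

theorem gellMannLow_formalPicard (hε : 0 < ε) (hH : IsDecaying C ε H) (hPP : P * P = P)
    (hP : ‖P‖ ≤ 1) (hP' : ‖1 - P‖ ≤ 1) :
    gellMannLow (PowerSeries.C P) (formalPicard H) =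
      PowerSeries.C P + (1 - PowerSeries.C P) * formalReg P H * PowerSeries.C P := by
  rw [gellMannLow_eq_of_isInverseOn (by rw [← map_mul, hPP])
    (isInverseOn_formalPicard hε hH hPP hP hP'),
    formalPicard_mul_C_mul_inverse hε hH hPP hP hP']

theorem formalPicard_mul_C_eq (hε : 0 < ε) (hH : IsDecaying C ε H) (hPP : P * P = P)
    (hP : ‖P‖ ≤ 1) (hP' : ‖1 - P‖ ≤ 1) :
    formalPicard H * PowerSeries.C P =
      (PowerSeries.C P + (1 - PowerSeries.C P) * formalReg P H * PowerSeries.C P) *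
        (PowerSeries.C P * formalPicard H * PowerSeries.C P) := by
  rw [← formalPicard_mul_C_mul_inverse hε hH hPP hP hP', mul_assoc,
    (isInverseOn_formalPicard hε hH hPP hP hP').2.1, mul_assoc, ← map_mul, hPP]

theorem mul_eq_of_strongSum (hε : 0 < ε) (hH : IsDecaying C ε H) (hPP : P * P = P)
    (hP : ‖P‖ ≤ 1) (hP' : ‖1 - P‖ ≤ 1) {W S : E →L[ℂ] E} (hW : HasSum (picardTerm H) W)
    (hS : StrongSum (fun n => (1 - P) * regBracket P H (n + 1) * P) ((1 - P) * S * P)) :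
    W * P = (P + (1 - P) * S * P) * (P * W * P) := by
  have hQ : (1 : PowerSeries (E →L[ℂ] E)) - PowerSeries.C P = PowerSeries.C (1 - P) := by simp
  let a : ℕ → E →L[ℂ] E := fun n => PowerSeries.coeff n
    (PowerSeries.C P + (1 - PowerSeries.C P) * formalReg P H * PowerSeries.C P)
  have ha0 : a 0 = P := by
    simp only [a, hQ, map_add, PowerSeries.coeff_mul_C, PowerSeries.coeff_C_mul, formalReg,
      PowerSeries.coeff_mk, PowerSeries.coeff_C]
    simp
  have ha1 : ∀ n, a (n + 1) = (1 - P) * regBracket P H (n + 1) * P := by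
    intro n
    simp only [a, hQ, map_add, PowerSeries.coeff_mul_C, PowerSeries.coeff_C_mul, formalReg,
      PowerSeries.coeff_mk, PowerSeries.coeff_C]
    simp
  have ha : StrongSum a (P + (1 - P) * S * P) := by
    intro x
    -- The hypothesis sums from order one on; the shift splits off the order-zero term `P`.
    rw [← tendsto_add_atTop_iff_nat 1]
    simp only [Finset.sum_range_succ', ha0, ha1]
    rw [add_comm P, add_apply]
    exact (hS x).add_const _
  have hnorm : Summable fun n => ‖picardTerm H n‖ := by
    simp only [picardTerm_eq_iterInt hε hH]
    exact summable_norm_iterInt_zero_right hε hH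
  have hc : Summable fun n => ‖P * picardTerm H n * P‖ :=
    ((hnorm.mul_left ‖P‖).mul_right ‖P‖).of_nonneg_of_le (fun _ => norm_nonneg _) fun n =>
      (norm_mul_le _ _).trans (mul_le_mul_of_nonneg_right (norm_mul_le _ _) (norm_nonneg _))
  refine eq_mul_of_coeff_eq ha hc ((hW.mul_left P).mul_right P) (hW.mul_right P) fun n => ?_
  have h := congrArg (PowerSeries.coeff n) (formalPicard_mul_C_eq hε hH hPP hP hP')
  rw [PowerSeries.coeff_mul_C, PowerSeries.coeff_mul] at h
  simpa only [PowerSeries.coeff_mul_C, PowerSeries.coeff_C_mul, formalPicard,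
    PowerSeries.coeff_mk] using h

theorem gellMannLow_eq_of_strongSum (hε : 0 < ε) (hH : IsDecaying C ε H) (hPP : P * P = P)
    (hP : ‖P‖ ≤ 1) (hP' : ‖1 - P‖ ≤ 1) {W S : E →L[ℂ] E} (hW : HasSum (picardTerm H) W)
    (hS : StrongSum (fun n => (1 - P) * regBracket P H (n + 1) * P) ((1 - P) * S * P))
    (hinv : InvertibleOn P (P * W * P)) :
    gellMannLow P W = P + (1 - P) * S * P := by
  obtain ⟨w, hw⟩ := hinv
  rw [gellMannLow_eq_of_isInverseOn hPP hw, mul_eq_of_strongSum hε hH hPP hP hP' hW hS, mul_assoc,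
    hw.2.2, add_mul, hPP, mul_assoc _ P P, hPP]

theorem IsEvolution.hasSum_picardTerm {Φ : HilbertBasis ι ℂ E} {en : ι → ℝ} {V : E →L[ℂ] E}
    {U : ℝ → E →L[ℂ] E} (hU : IsEvolution Φ en V ε U) (hε : 0 < ε) :
    HasSum (picardTerm (Hi Φ en V ε)) (U 0) :=
  (hU.hasSum_iterInt hε).congr_fun fun n =>
    picardTerm_eq_iterInt hε (isDecaying_Hi Φ en V hε) n

end Operators

/-! ### The limit `ε → 0⁺` and the main theorem. -/

theorem strongLim_congr {E : Type*} [NormedAddCommGroup E] [InnerProductSpace ℂ E]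
    {F G : ℝ → E →L[ℂ] E} {W : E →L[ℂ] E} (h : F =ᶠ[𝓝[>] 0] G) :
    StrongLim F W ↔ StrongLim G W :=
  forall_congr' fun x => tendsto_congr' (h.mono fun ε hε => by simp only [hε])

end

end HyperPicard

open HyperPicard in
theorem mainTheorem1 {ι E : Type*} [NormedAddCommGroup E] [InnerProductSpace ℂ E]
    [CompleteSpace E] (Φ : HilbertBasis ι ℂ E) (en : ι → ℝ) (E₀ : ℝ)
    (hE₀ : IsLeast (Set.range en) E₀)
    (V : E →L[ℂ] E) (hV : IsSelfAdjoint V)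
    (U : ℝ → ℝ → E →L[ℂ] E) (hU : ∀ ε > 0, IsEvolution Φ en V ε (U ε))
    (P : E →L[ℂ] E) (hP : P = eigenProj Φ en E₀) :
    -- the formal expansion in the coupling constant, for every `ε > 0`
    (∀ ε > 0,
      HasSum (picardTerm (Hi Φ en V ε)) (U ε 0) ∧
      formalPicard (Hi Φ en V ε) * PowerSeries.C P =
        (PowerSeries.C P + (1 - PowerSeries.C P) * formalReg P (Hi Φ en V ε) * PowerSeries.C P) *
          (PowerSeries.C P * formalPicard (Hi Φ en V ε) * PowerSeries.C P) ∧
      InvertibleOn (PowerSeries.C P)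
        (PowerSeries.C P * formalPicard (Hi Φ en V ε) * PowerSeries.C P) ∧
      gellMannLow (PowerSeries.C P) (formalPicard (Hi Φ en V ε)) =
        PowerSeries.C P + (1 - PowerSeries.C P) * formalReg P (Hi Φ en V ε) * PowerSeries.C P) ∧
    -- the operator identities, for every `ε > 0` for which the series converges
    (∀ ε > 0, ∀ S : E →L[ℂ] E,
      StrongSum (fun n => (1 - P) * regBracket P (Hi Φ en V ε) (n + 1) * P) ((1 - P) * S * P) →
      U ε 0 * P = (P + (1 - P) * S * P) * (P * U ε 0 * P) ∧
      (InvertibleOn P (P * U ε 0 * P) →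
        gellMannLow P (U ε 0) = P + (1 - P) * S * P)) ∧
    -- the limit `ε → 0`, formally (coefficient by coefficient)
    (∀ (n : ℕ) (W : E →L[ℂ] E),
      (Tendsto (fun ε => PowerSeries.coeff n
          (gellMannLow (PowerSeries.C P) (formalPicard (Hi Φ en V ε)))) (𝓝[>] 0) (𝓝 W) ↔
        Tendsto (fun ε => PowerSeries.coeff n (PowerSeries.C P +
          (1 - PowerSeries.C P) * formalReg P (Hi Φ en V ε) * PowerSeries.C P))
            (𝓝[>] 0) (𝓝 W)) ∧
      (StrongLim (fun ε => PowerSeries.coeff n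
          (gellMannLow (PowerSeries.C P) (formalPicard (Hi Φ en V ε)))) W ↔
        StrongLim (fun ε => PowerSeries.coeff n (PowerSeries.C P +
          (1 - PowerSeries.C P) * formalReg P (Hi Φ en V ε) * PowerSeries.C P)) W)) ∧
    -- the limit `ε → 0` of the operators
    (∀ S : ℝ → E →L[ℂ] E,
      (∀ᶠ ε in 𝓝[>] 0, InvertibleOn P (P * U ε 0 * P)) →
      (∀ᶠ ε in 𝓝[>] 0,
        StrongSum (fun n => (1 - P) * regBracket P (Hi Φ en V ε) (n + 1) * P)
          ((1 - P) * S ε * P)) →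
      ∀ UGL : E →L[ℂ] E,
        (Tendsto (fun ε => gellMannLow P (U ε 0)) (𝓝[>] 0) (𝓝 UGL) ↔
          Tendsto (fun ε => P + (1 - P) * S ε * P) (𝓝[>] 0) (𝓝 UGL)) ∧
        (StrongLim (fun ε => gellMannLow P (U ε 0)) UGL ↔
          StrongLim (fun ε => P + (1 - P) * S ε * P) UGL)) := by
  have hPP : P * P = P := by rw [hP]; exact (eigenspace Φ en E₀).isIdempotentElem_starProjection
  have hP1 : ‖P‖ ≤ 1 := by rw [hP]; exact (eigenspace Φ en E₀).starProjection_norm_le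
  -- As the projection on the orthogonal complement, `1 - P` is a contraction, so `A` and `B`
  -- inherit the decay bound of `H` with the same constant.
  have hP2 : ‖1 - P‖ ≤ 1 := by
    have h : 1 - P = (eigenspace Φ en E₀)ᗮ.starProjection := by
      rw [hP, Submodule.starProjection_orthogonal]
      rfl
    rw [h]
    exact Submodule.starProjection_norm_le _
  have hH : ∀ ε > 0, IsDecaying ‖V‖ ε (Hi Φ en V ε) := fun ε hε => isDecaying_Hi Φ en V hε
  have hpos : ∀ᶠ ε : ℝ in 𝓝[>] 0, 0 < ε := eventually_mem_nhdsWithin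
  refine ⟨fun ε hε => ⟨(hU ε hε).hasSum_picardTerm hε,
    formalPicard_mul_C_eq hε (hH ε hε) hPP hP1 hP2,
    ⟨_, isInverseOn_formalPicard hε (hH ε hε) hPP hP1 hP2⟩,
    gellMannLow_formalPicard hε (hH ε hε) hPP hP1 hP2⟩, fun ε hε S hS => ⟨?_, fun hinv => ?_⟩,
    fun n W => ?_, fun S hinv hS UGL => ?_⟩
  · exact mul_eq_of_strongSum hε (hH ε hε) hPP hP1 hP2 ((hU ε hε).hasSum_picardTerm hε) hS
  · exact gellMannLow_eq_of_strongSum hε (hH ε hε) hPP hP1 hP2 ((hU ε hε).hasSum_picardTerm hε) hS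
      hinv
  -- The two families agree for every `ε > 0`, so each kind of limit transfers at once.
  · have h : (fun ε => PowerSeries.coeff n
        (gellMannLow (PowerSeries.C P) (formalPicard (Hi Φ en V ε)))) =ᶠ[𝓝[>] 0]
        fun ε => PowerSeries.coeff n (PowerSeries.C P +
          (1 - PowerSeries.C P) * formalReg P (Hi Φ en V ε) * PowerSeries.C P) :=
      hpos.mono fun ε hε => by
        simp only [gellMannLow_formalPicard hε (hH ε hε) hPP hP1 hP2]
    exact ⟨tendsto_congr' h, strongLim_congr h⟩
  · have h : (fun ε => gellMannLow P (U ε 0)) =ᶠ[𝓝[>] 0]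
        fun ε => P + (1 - P) * S ε * P := by
      filter_upwards [hpos, hinv, hS] with ε hε hi hs
      exact gellMannLow_eq_of_strongSum hε (hH ε hε) hPP hP1 hP2
        ((hU ε hε).hasSum_picardTerm hε) hs hi
    exact ⟨tendsto_congr' h, strongLim_congr h⟩
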